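/- **Setting.** Let $k\ge 1$, $\lambda_0,\dots,\lambda_{k-1}>0$, $q_{k-1}=0$ and $0<q_i\le 1$ for $0\le i\le k-2$. The $Cox(k)$ distribution is the law of the time $C$ built as follows: phase $i$ (starting with $i=0$) lasts an exponential time of rate $\lambda_i$; at its end, independently, phase $i+1$ starts with probability $q_i$, and with probability $1-q_i$ the time $C$ ends. Let $\mu>0$, and let the batch size $Y$ satisfy $P(Y=j)=p_j\ge 0$ for $1\le j\le b$, $\sum_{j=1}^b p_j=1$, with generating function $\phi_Y(x)=\sum_{j=1}^b p_jx^j$. The $Cox(k)/M^Y/1$ queue is the continuous-time Markov process on $\{(m,i): m\ge 0,\ 0\le i\le k-1\}$ ($m$ customers are present, and the next arriving customer has completed $i$ arrival phases) with transitions - $(m,i)\to(m,i+1)$ at rate $q_i\lambda_i$ (for $i\le k-2$), - $(m,i)\to(m+1,0)$ at rate $(1-q_i)\lambda_i$, - $(m,i)\to(\max(m-j,0),i)$ at rate $\mu p_j$, for $m\ge 1$ and $1\le j\le b$. It is called ergodic if, from every initial state, its law at time $t$ converges as $t\to\infty$ to one and the same strictly positive probability distribution. **Theorem.** One has $E[C]=\sum_{i=0}^{k-1}\lambda_i^{-1}\prod_{l=0}^{i-1}q_l$,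 and the queue is ergodic if and only if $$\frac{1}{E[C]}<\mu\,E[Y]=\mu\sum_{j=1}^b jp_j .$$ In that case the map $$F(\gamma)=\frac{\lambda_0(1-q_0)+\sum_{i=1}^{k-1}\Big(\prod_{l=1}^{i}q_{l-1}\frac{\lambda_{l-1}}{\lambda_l+\mu-\mu\phi_Y(\gamma)}\Big)(1-q_i)\lambda_i+\gamma\mu\phi_Y(\gamma)}{\lambda_0+\mu}$$ has exactly one fixpoint $\gamma$ in $[0,1)$, and $\gamma>0$. With this $\gamma$ and $$\alpha_i=\frac{\lambda_{i-1}}{\lambda_i+\mu-\mu\phi_Y(\gamma)}\qquad(1\le i\le k-1),$$ the queue has exactly one stationary distribution $\pi$, and it is given by $$\pi_{(m,i)}=\pi_{(0,0)}\,\frac{\lambda_0(1-\gamma)\gamma^{m-1}}{\mu(1-\phi_Y(\gamma))}\prod_{l=1}^{i}q_{l-1}\alpha_l\qquad(m\ge 1,\ 0\le i\le k-1),$$ $$\pi_{(0,i)}=\pi_{(0,0)}\,\frac{\lambda_0}{\lambda_i}\Big(\prod_{s=0}^{i-1}q_s\Big)\Big(1+\sum_{j=1}^{i}\prod_{l=1}^{j}\alpha_l\Big)\qquad(1\le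 i\le k-1),$$ $$\pi_{(0,0)}=\left(\Big(1+\frac{\lambda_0}{\mu(1-\phi_Y(\gamma))}\Big)\Big(1+\sum_{i=1}^{k-1}\frac{\lambda_0}{\lambda_i}\prod_{j=0}^{i-1}q_j\Big)\right)^{-1}.$$ -/

import Mathlib

open MeasureTheory ProbabilityTheory Filter Topology
open scoped ENNReal

noncomputable section

/-- Data of a `Cox(k)/M^Y/1` queue. Arrival phase `i < k` is exponential with rate `lam i`; at its
end a new phase starts with probability `q i`, and a customer arrives with probability `1 - q i`.
Services take place at rate `mu`, in batches of size `Y`, where `P(Y = j) = p j` for `1 ≤ j ≤ b`.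
Only `lam i`, `q i` with `i < k` and `p j` with `1 ≤ j ≤ b` are ever used. -/
structure CoxQueue (k : ℕ) where
  lam : ℕ → ℝ
  q : ℕ → ℝ
  mu : ℝ
  b : ℕ
  p : ℕ → ℝ
  lam_pos : ∀ i < k, 0 < lam i
  q_pos : ∀ i, i + 1 < k → 0 < q i
  q_le_one : ∀ i, i + 1 < k → q i ≤ 1
  q_last : ∀ i, i + 1 = k → q i = 0
  mu_pos : 0 < mu
  p_nonneg : ∀ j ∈ Finset.Icc 1 b, 0 ≤ p j
  p_sum : ∑ j ∈ Finset.Icc 1 b, p j = 1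

namespace CoxQueue

variable {k : ℕ}

/-! ### Inter-arrival times and batch sizes -/

/-- Law of the time until the next arrival when phase `i` starts and at most `n` phases are left:
an exponential time of rate `lam i`, followed by an independent time that is zero with probability
`1 - q i` and the remaining time from phase `i + 1` on with probability `q i`. -/
def coxLawFrom (Q : CoxQueue k) : ℕ → ℕ → Measure ℝ
  | 0, _ => Measure.dirac 0
  | n + 1, i => Measure.conv (expMeasure (Q.lam i))
      (ENNReal.ofReal (1 - Q.q i) • Measure.dirac 0 +
        ENNReal.ofReal (Q.q i) • coxLawFrom Q n (i + 1))

/-- The law `Cox(k)` of the inter-arrival time `C`. -/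
def coxLaw (Q : CoxQueue k) : Measure ℝ := Q.coxLawFrom k 0

/-- The mean inter-arrival time `E[C]`. -/
def meanInterarrival (Q : CoxQueue k) : ℝ := ∫ x, x ∂Q.coxLaw

/-- The mean batch size `E[Y]`. -/
def meanBatch (Q : CoxQueue k) : ℝ := ∑ j ∈ Finset.Icc 1 Q.b, (j : ℝ) * Q.p j

/-- The probability generating function `φ_Y` of the batch size. -/
def phi (Q : CoxQueue k) (x : ℝ) : ℝ := ∑ j ∈ Finset.Icc 1 Q.b, Q.p j * x ^ j

/-! ### The Markov process -/

/-- State `(m, i)`: there are `m` customers in the system and the customer who arrives next has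
completed `i` arrival phases. -/
abbrev State (k : ℕ) : Type := ℕ × Fin k

/-- The generator, `(G f)(x) = ∑_y Q(x, y) f(y)`, where the `q`-matrix `Q` has the transitions
* `(m, i) → (m, i + 1)` at rate `q i * lam i` (this rate is `0` if `i = k - 1`, so that it does not
  matter that `i + 1` is taken modulo `k`);
* `(m, i) → (m + 1, 0)` at rate `(1 - q i) * lam i`;
* `(m, i) → (max (m - j) 0, i)` at rate `mu * p j`, for `1 ≤ j ≤ b`.
The subtraction `m - j` is the truncated one, so a batch that is larger than the number of customers
empties the system, and nothing happens if there are no customers. -/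
def genFun [NeZero k] (Q : CoxQueue k) (f : State k → ℝ) : State k → ℝ := fun x =>
  Q.q x.2 * Q.lam x.2 * (f (x.1, x.2 + 1) - f x)
    + (1 - Q.q x.2) * Q.lam x.2 * (f (x.1 + 1, 0) - f x)
    + ∑ j ∈ Finset.Icc 1 Q.b, Q.mu * Q.p j * (f (x.1 - j, x.2) - f x)

/-- A bound for the norm of the generator on bounded functions. -/
def genBound (Q : CoxQueue k) : ℝ :=
  2 * ((∑ i : Fin k, (|Q.q i * Q.lam i| + |(1 - Q.q i) * Q.lam i|))
    + ∑ j ∈ Finset.Icc 1 Q.b, |Q.mu * Q.p j|)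

theorem genFun_bound [NeZero k] (Q : CoxQueue k) (f : State k → ℝ) (C : ℝ)
    (hf : ∀ x, ‖f x‖ ≤ C) (x : State k) : ‖Q.genFun f x‖ ≤ Q.genBound * C := by
  have hd : ∀ y, |f y - f x| ≤ 2 * C := fun y => by
    have h1 := abs_le.1 (hf y)
    have h2 := abs_le.1 (hf x)
    exact abs_le.2 ⟨by linarith, by linarith⟩
  have hC : 0 ≤ 2 * C := (abs_nonneg _).trans (hd x)
  have hs : |Q.q x.2 * Q.lam x.2| + |(1 - Q.q x.2) * Q.lam x.2|
      ≤ ∑ i : Fin k, (|Q.q i * Q.lam i| + |(1 - Q.q i) * Q.lam i|) :=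
    Finset.single_le_sum (f := fun i : Fin k =>
      |Q.q i * Q.lam i| + |(1 - Q.q i) * Q.lam i|) (fun i _ => by positivity) (Finset.mem_univ x.2)
  have hm : ∀ (a : ℝ) (y : State k), |a * (f y - f x)| ≤ |a| * (2 * C) := fun a y => by
    rw [abs_mul]
    exact mul_le_mul_of_nonneg_left (hd y) (abs_nonneg a)
  have h3 : |∑ j ∈ Finset.Icc 1 Q.b, Q.mu * Q.p j * (f (x.1 - j, x.2) - f x)|
      ≤ (∑ j ∈ Finset.Icc 1 Q.b, |Q.mu * Q.p j|) * (2 * C) := by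
    rw [Finset.sum_mul]
    exact (Finset.abs_sum_le_sum_abs _ _).trans (Finset.sum_le_sum fun j _ => hm _ _)
  have h4 := mul_le_mul_of_nonneg_right hs hC
  have h1 := hm (Q.q x.2 * Q.lam x.2) (x.1, x.2 + 1)
  have h2 := hm ((1 - Q.q x.2) * Q.lam x.2) (x.1 + 1, 0)
  calc ‖Q.genFun f x‖ ≤ _ := (abs_add_le _ _).trans (add_le_add (abs_add_le _ _) le_rfl)
    _ ≤ Q.genBound * C := by
      unfold genBound
      nlinarith

/-- The Banach space `ℓ^∞` of bounded functions on the state space. -/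
abbrev Bdd (k : ℕ) : Type := lp (fun _ : State k => ℝ) ∞

theorem genFun_norm_le [NeZero k] (Q : CoxQueue k) (f : Bdd k) (x : State k) :
    ‖Q.genFun f x‖ ≤ Q.genBound * ‖f‖ :=
  Q.genFun_bound f ‖f‖ (lp.norm_apply_le_norm ENNReal.top_ne_zero f) x

/-- The generator as a bounded operator on `ℓ^∞`. -/
def gen [NeZero k] (Q : CoxQueue k) : Bdd k →L[ℝ] Bdd k :=
  LinearMap.mkContinuous
    { toFun := fun f => ⟨Q.genFun f, memℓp_infty ⟨Q.genBound * ‖f‖, by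
        rintro _ ⟨x, rfl⟩
        exact Q.genFun_norm_le f x⟩⟩
      map_add' := fun f g => by
        ext x
        simp only [genFun, lp.coeFn_add, Pi.add_apply]
        rw [show ∀ a b c d e h : ℝ, a + b + c + (d + e + h) = (a + d) + (b + e) + (c + h) from
          fun _ _ _ _ _ _ => by ring, ← Finset.sum_add_distrib]
        congr 1
        · ring
        · exact Finset.sum_congr rfl fun j _ => by ring
      map_smul' := fun c f => by
        ext x
        simp only [genFun, lp.coeFn_smul, Pi.smul_apply, smul_eq_mul, RingHom.id_apply, mul_add,
          Finset.mul_sum]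
        congr 1
        · ring
        · exact Finset.sum_congr rfl fun j _ => by ring }
    Q.genBound
    (fun f => lp.norm_le_of_forall_le
      ((norm_nonneg _).trans (Q.genFun_norm_le f (0, 0))) (Q.genFun_norm_le f))

/-- The transition function `P_t(x, y)` of the process: since the rates are bounded, the transition
semigroup is `P_t = exp (t G)`, and `P_t(x, y) = (P_t 1_{y})(x)`. -/
def trans [NeZero k] (Q : CoxQueue k) (t : ℝ) (x y : State k) : ℝ :=
  (NormedSpace.exp (t • Q.gen) (lp.single ∞ y (1 : ℝ)) : Bdd k) x

/-- `π` is a probability distribution on the state space. -/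
def IsProb (π : State k → ℝ) : Prop := (∀ x, 0 ≤ π x) ∧ HasSum π 1

/-- `π` is a stationary distribution: a probability distribution with `π P_t = π` for `t ≥ 0`. -/
def IsStationary [NeZero k] (Q : CoxQueue k) (π : State k → ℝ) : Prop :=
  IsProb π ∧ ∀ t : ℝ, 0 ≤ t → ∀ y, HasSum (fun x => π x * Q.trans t x y) (π y)

/-- The process is ergodic: whatever the initial state, its law at time `t` converges for `t → ∞` to
one and the same probability distribution, and this distribution charges every state. -/
def IsErgodic [NeZero k] (Q : CoxQueue k) : Prop :=
  ∃ π : State k → ℝ, IsProb π ∧ (∀ y, 0 < π y) ∧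
    ∀ x y, Tendsto (fun t : ℝ => Q.trans t x y) atTop (𝓝 (π y))

/-! ### The explicit quantities -/

/-- `α_i` as a function of `γ`, for `1 ≤ i ≤ k - 1`. -/
def alpha (Q : CoxQueue k) (γ : ℝ) (i : ℕ) : ℝ :=
  Q.lam (i - 1) / (Q.lam i + Q.mu - Q.mu * Q.phi γ)

/-- The map `F` whose fixpoint is the level factor `γ`. -/
def fixMap (Q : CoxQueue k) (γ : ℝ) : ℝ :=
  (Q.lam 0 * (1 - Q.q 0)
    + ∑ i ∈ Finset.Icc 1 (k - 1),
        (∏ l ∈ Finset.Icc 1 i,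
          Q.q (l - 1) * (Q.lam (l - 1) / (Q.lam l + Q.mu - Q.mu * Q.phi γ)))
        * (1 - Q.q i) * Q.lam i
    + γ * Q.mu * Q.phi γ) / (Q.lam 0 + Q.mu)

end CoxQueue

end

/-! ### Mean of the Cox distribution. -/

namespace CoxQueue

variable {k : ℕ}

/-! The rates are bounded, so the process is the semigroup `exp (t G)` on `ℓ^∞`, and a probability
distribution `π` with `π G = 0` is stationary. Everything rests on three arguments.

Convergence (`tendsto_semigroup`): if such a `π` is strictly positive, then `P_t f → π f` pointwise.
By Jensen and invariance, `π ((P_t f)²)` decreases in `t`, so any limit point `g` of `P_t f`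
satisfies `π ((P_1 g)²) = π (g²)`. Equality in Jensen makes `g` constant along every transition of
positive rate. Since the arrival transitions connect all states, `g` is the constant `π f`. A limit
law of this kind is also the only stationary one (`IsStationary.eq_of_tendsto`).

Necessity of the stability condition (`stable_of_expect_gen`): an ergodic limit satisfies `π G = 0`.
It is tested against the truncated number of customers, minus the mean remaining time to the next
arrival in units of `E[C]`. The correction turns the arrival drift into the constant `1 / E[C]`,
while the service drift is at least `-μ E[Y]` and vanishes at the empty states. Their positive mass
makes the inequality strict.

Sufficiency and the formulas: `(λ_0 + μ) (F γ - γ) = (1 - γ) H γ` with `H 0 > 0` and `H 1 = λ_0 (1 -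
μ E[Y] E[C])`, which is negative under stability. The intermediate value theorem gives a fixpoint
(`exists_fixpoint`). Each fixpoint in `(0, 1)` makes the explicit law `geomDist` satisfy the balance
equations (`geom_balance`), so the convergence theorem applies. Uniqueness of the fixpoint follows
from uniqueness of the stationary law, because `γ` is the ratio of its masses at `(2, 0)` and `(1,
0)`. -/

lemma mul_gammaPDFReal_one {r : ℝ} (hr : 0 < r) (x : ℝ) :
    gammaPDFReal 1 r x * x = r⁻¹ * gammaPDFReal 2 r x := by
  unfold gammaPDFReal
  split_ifs
  · rw [Real.Gamma_two, Real.Gamma_one]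
    norm_num
    field_simp
  · simp

/-- Size-biasing `Gamma(1)` gives `r⁻¹` times the `Gamma(2)` density, whose total mass is one; no
integration by parts is needed. -/
lemma hasFiniteMean_expMeasure {r : ℝ} (hr : 0 < r) :
    Integrable (fun x : ℝ => x) (expMeasure r) ∧ ∫ x, x ∂(expMeasure r) = r⁻¹ := by
  have h1 := lintegral_gammaPDF_eq_one (a := 2) two_pos hr
  have h0 : 0 ≤ᵐ[volume] gammaPDFReal 2 r :=
    Eventually.of_forall fun x => gammaPDFReal_nonneg two_pos hr x
  have hm := (stronglyMeasurable_gammaPDFReal 2 r).aestronglyMeasurable (μ := volume)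
  have hint : Integrable (gammaPDFReal 2 r) := by
    refine (lintegral_ofReal_ne_top_iff_integrable hm h0).1 ?_
    unfold gammaPDF at h1
    simp [h1]
  have hval : ∫ x, gammaPDFReal 2 r x = 1 := by
    rw [integral_eq_lintegral_of_nonneg_ae h0 hm]
    unfold gammaPDF at h1
    simp [h1]
  have hfin : ∀ᵐ x ∂(volume : Measure ℝ), gammaPDF 1 r x < ∞ :=
    Eventually.of_forall fun x => ENNReal.ofReal_lt_top
  have hmeas : Measurable (gammaPDF 1 r) := (measurable_gammaPDFReal 1 r).ennreal_ofReal
  have hden : ∀ x, (gammaPDF 1 r x).toReal • x = r⁻¹ * gammaPDFReal 2 r x := fun x => by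
    rw [gammaPDF, ENNReal.toReal_ofReal (gammaPDFReal_nonneg one_pos hr x), smul_eq_mul,
      mul_gammaPDFReal_one hr]
  unfold expMeasure gammaMeasure
  refine ⟨?_, ?_⟩
  · rw [integrable_withDensity_iff_integrable_smul' hmeas hfin]
    simp_rw [hden]
    exact hint.const_mul _
  · rw [integral_withDensity_eq_integral_toReal_smul hmeas hfin]
    simp_rw [hden]
    rw [integral_const_mul, hval, mul_one]

/-- Mean time until the next arrival when phase `i` starts and at most `n` phases are left. -/
noncomputable def meanFrom (Q : CoxQueue k) : ℕ → ℕ → ℝ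
  | 0, _ => 0
  | n + 1, i => (Q.lam i)⁻¹ + Q.q i * meanFrom Q n (i + 1)

lemma q_nonneg (Q : CoxQueue k) {i : ℕ} (hi : i < k) : 0 ≤ Q.q i := by
  rcases Nat.lt_or_ge (i + 1) k with h | h
  · exact (Q.q_pos i h).le
  · exact (Q.q_last i (by omega)).ge

lemma q_le (Q : CoxQueue k) {i : ℕ} (hi : i < k) : Q.q i ≤ 1 := by
  rcases Nat.lt_or_ge (i + 1) k with h | h
  · exact Q.q_le_one i h
  · rw [Q.q_last i (by omega)]
    exact zero_le_one

lemma integral_conv_id {μ ν : Measure ℝ} [IsProbabilityMeasure μ] [IsProbabilityMeasure ν]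
    (hμ : Integrable (fun x : ℝ => x) μ) (hν : Integrable (fun x : ℝ => x) ν) :
    Integrable (fun x : ℝ => x) (Measure.conv μ ν) ∧
      ∫ x, x ∂(Measure.conv μ ν) = ∫ x, x ∂μ + ∫ x, x ∂ν := by
  have hint : Integrable (fun x : ℝ => x) (Measure.conv μ ν) := by
    unfold Measure.conv
    rw [integrable_map_measure (by fun_prop) (by fun_prop)]
    exact (hμ.comp_fst ν).add (hν.comp_snd μ)
  refine ⟨hint, ?_⟩
  rw [integral_conv hint]
  have : ∀ x : ℝ, ∫ y, (x + y) ∂ν = x + ∫ y, y ∂ν := fun x => by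
    rw [integral_add (integrable_const _) hν]
    simp
  simp_rw [this]
  rw [integral_add hμ (integrable_const _)]
  simp

/-- The bound `i + n ≤ k` keeps the recursion within phases whose rate is positive and whose `q`
lies in `[0, 1]`. The three claims are proved together because the mean of a convolution needs the
other two. -/
lemma coxLawFrom_spec (Q : CoxQueue k) (n i : ℕ) (h : i + n ≤ k) :
    IsProbabilityMeasure (Q.coxLawFrom n i) ∧
      Integrable (fun x : ℝ => x) (Q.coxLawFrom n i) ∧
      ∫ x, x ∂(Q.coxLawFrom n i) = Q.meanFrom n i := by
  induction n generalizing i with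
  | zero =>
    simp only [coxLawFrom, meanFrom]
    exact ⟨inferInstance, integrable_dirac (by simp), by simp⟩
  | succ n ih =>
    obtain ⟨hp, hi, hm⟩ := ih (i + 1) (by omega)
    have hik : i < k := by omega
    obtain ⟨he, hem⟩ := hasFiniteMean_expMeasure (Q.lam_pos i hik)
    have := isProbabilityMeasure_expMeasure (Q.lam_pos i hik)
    have hq0 := Q.q_nonneg hik
    have hq1 := Q.q_le hik
    set ν : Measure ℝ := ENNReal.ofReal (1 - Q.q i) • Measure.dirac 0 +
        ENNReal.ofReal (Q.q i) • Q.coxLawFrom n (i + 1) with hν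
    have hνp : IsProbabilityMeasure ν := ⟨by
      simp only [hν, Measure.add_apply, Measure.smul_apply, measure_univ, smul_eq_mul, mul_one]
      rw [← ENNReal.ofReal_add (by linarith) hq0]
      simp⟩
    have hd : Integrable (fun x : ℝ => x) (ENNReal.ofReal (1 - Q.q i) • Measure.dirac (0 : ℝ)) :=
      (integrable_dirac (by simp)).smul_measure ENNReal.ofReal_ne_top
    have hc : Integrable (fun x : ℝ => x) (ENNReal.ofReal (Q.q i) • Q.coxLawFrom n (i + 1)) :=
      hi.smul_measure ENNReal.ofReal_ne_top
    have hνi : Integrable (fun x : ℝ => x) ν := hd.add_measure hc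
    have hνm : ∫ x, x ∂ν = Q.q i * Q.meanFrom n (i + 1) := by
      rw [hν, integral_add_measure hd hc, integral_smul_measure, integral_smul_measure, hm,
        ENNReal.toReal_ofReal hq0]
      simp
    obtain ⟨h1, h2⟩ := integral_conv_id he hνi
    refine ⟨?_, h1, ?_⟩
    · change IsProbabilityMeasure (Measure.conv _ ν)
      infer_instance
    · change ∫ x, x ∂(Measure.conv _ ν) = _
      rw [h2, hem, hνm, meanFrom]

lemma meanFrom_eq_sum (Q : CoxQueue k) (n i : ℕ) :
    Q.meanFrom n i
      = ∑ j ∈ Finset.range n, (∏ l ∈ Finset.range j, Q.q (i + l)) * (Q.lam (i + j))⁻¹ := by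
  induction n generalizing i with
  | zero => simp [meanFrom]
  | succ n ih =>
    rw [meanFrom, ih, Finset.sum_range_succ', Finset.mul_sum, add_comm]
    congr 1
    · refine Finset.sum_congr rfl fun j _ => ?_
      rw [Finset.prod_range_succ', add_zero, show i + 1 + j = i + (j + 1) by ring]
      simp_rw [show ∀ l, i + 1 + l = i + (l + 1) from fun l => by ring]
      ring
    · simp

lemma meanInterarrival_eq_meanFrom (Q : CoxQueue k) : Q.meanInterarrival = Q.meanFrom k 0 :=
  (Q.coxLawFrom_spec k 0 (by simp)).2.2

theorem meanInterarrival_eq (Q : CoxQueue k) :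
    Q.meanInterarrival
      = ∑ i ∈ Finset.range k, (∏ l ∈ Finset.range i, Q.q l) * (Q.lam i)⁻¹ := by
  rw [meanInterarrival_eq_meanFrom, meanFrom_eq_sum]
  simp

lemma meanFrom_nonneg (Q : CoxQueue k) (n i : ℕ) (h : i + n ≤ k) : 0 ≤ Q.meanFrom n i := by
  induction n generalizing i with
  | zero => exact le_rfl
  | succ n ih =>
    exact add_nonneg (inv_nonneg.2 (Q.lam_pos i (by omega)).le)
      (mul_nonneg (Q.q_nonneg (by omega)) (ih _ (by omega)))

lemma meanInterarrival_pos [NeZero k] (Q : CoxQueue k) : 0 < Q.meanInterarrival := by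
  rw [meanInterarrival_eq_meanFrom]
  obtain ⟨n, rfl⟩ := Nat.exists_eq_succ_of_ne_zero (NeZero.ne k)
  exact add_pos_of_pos_of_nonneg (inv_pos.2 (Q.lam_pos 0 (by omega)))
    (mul_nonneg (Q.q_nonneg (by omega)) (Q.meanFrom_nonneg _ _ (by omega)))

end CoxQueue

namespace CoxQueue

variable {k : ℕ}

/-! ### Exponentials of bounded operators -/

section Exponential

lemma exp_add_smul {A : Type*} [NormedRing A] [NormedAlgebra ℝ A] [CompleteSpace A] (a : A)
    (s t : ℝ) :
    NormedSpace.exp ((s + t) • a) = NormedSpace.exp (s • a) * NormedSpace.exp (t • a) := by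
  let _ : NormedAlgebra ℚ A := NormedAlgebra.restrictScalars ℚ ℝ A
  rw [add_smul]
  exact NormedSpace.exp_add_of_commute (((Commute.refl a).smul_left s).smul_right t)

lemma exp_zero_smul {A : Type*} [NormedRing A] [NormedAlgebra ℝ A] (a : A) :
    NormedSpace.exp ((0 : ℝ) • a) = 1 := by
  rw [zero_smul, NormedSpace.exp_zero]

/-- Uniformization: adding a multiple of the identity makes the generator a positive operator, at
the price of a scalar factor. -/
lemma exp_smul_eq_shift {A : Type*} [NormedRing A] [NormedAlgebra ℝ A] [CompleteSpace A] (a : A)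
    (c t : ℝ) :
    NormedSpace.exp (t • a)
      = Real.exp (-(t * c)) • NormedSpace.exp (t • (a + c • (1 : A))) := by
  let _ : NormedAlgebra ℚ A := NormedAlgebra.restrictScalars ℚ ℝ A
  have h1 : t • a = (-(t * c)) • (1 : A) + t • (a + c • (1 : A)) := by
    simp only [smul_add, smul_smul, neg_smul]
    abel
  have h2 : Commute ((-(t * c)) • (1 : A)) (t • (a + c • (1 : A))) :=
    (Commute.one_left _).smul_left _
  have h3 : NormedSpace.exp ((-(t * c)) • (1 : A)) = Real.exp (-(t * c)) • (1 : A) := by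
    rw [← Algebra.algebraMap_eq_smul_one, ← Algebra.algebraMap_eq_smul_one,
      Real.exp_eq_exp_ℝ, NormedSpace.algebraMap_exp_comm]
  conv_lhs => rw [h1]
  rw [NormedSpace.exp_add_of_commute h2, h3, smul_mul_assoc, one_mul]

variable {E : Type*} [NormedAddCommGroup E] [NormedSpace ℝ E]

lemma norm_pow_apply_le (A : E →L[ℝ] E) (n : ℕ) (f : E) : ‖(A ^ n) f‖ ≤ ‖A‖ ^ n * ‖f‖ := by
  induction n with
  | zero => simp
  | succ n ih =>
    rw [pow_succ' A]
    refine (A.le_opNorm _).trans ?_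
    rw [pow_succ', mul_assoc]
    exact mul_le_mul_of_nonneg_left ih (norm_nonneg _)

lemma hasSum_exp_smul_apply [CompleteSpace E] (A : E →L[ℝ] E) (t : ℝ) (f : E) :
    HasSum (fun n : ℕ => ((n.factorial : ℝ)⁻¹ * t ^ n) • (A ^ n) f)
      (NormedSpace.exp (t • A) f) := by
  have h := (NormedSpace.exp_series_hasSum_exp' (𝕂 := ℝ) (t • A)).mapL
    (ContinuousLinearMap.apply ℝ E f)
  refine h.congr_fun fun n => ?_
  simp [smul_pow, smul_smul]

lemma hasDerivAt_exp_smul_apply [CompleteSpace E] (A : E →L[ℝ] E) (f : E) (t : ℝ) :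
    HasDerivAt (fun s : ℝ => NormedSpace.exp (s • A) f) (NormedSpace.exp (t • A) (A f)) t := by
  simpa using (hasDerivAt_exp_smul_const (𝕂 := ℝ) A t).clm_apply (hasDerivAt_const t f)

lemma hasDerivAt_exp_smul_apply' [CompleteSpace E] (A : E →L[ℝ] E) (f : E) (t : ℝ) :
    HasDerivAt (fun s : ℝ => NormedSpace.exp (s • A) f) (A (NormedSpace.exp (t • A) f)) t := by
  simpa using (hasDerivAt_exp_smul_const' (𝕂 := ℝ) A t).clm_apply (hasDerivAt_const t f)

end Exponential

/-! ### The transition semigroup -/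

lemma bdd_abs_le (f : Bdd k) (x : State k) : |f x| ≤ ‖f‖ :=
  lp.norm_apply_le_norm ENNReal.top_ne_zero f x

lemma bdd_norm_le {f : Bdd k} {C : ℝ} (hC : 0 ≤ C) (h : ∀ x, |f x| ≤ C) : ‖f‖ ≤ C :=
  lp.norm_le_of_forall_le hC h

/-- A bounded function as an element of `ℓ^∞`. -/
def toBdd (f : State k → ℝ) (C : ℝ) (h : ∀ x, |f x| ≤ C) : Bdd k :=
  ⟨f, memℓp_infty ⟨C, by rintro _ ⟨x, rfl⟩; exact h x⟩⟩

@[simp] lemma toBdd_apply (f : State k → ℝ) (C : ℝ) (h : ∀ x, |f x| ≤ C) (x : State k) :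
    toBdd f C h x = f x := rfl

@[simp] lemma bdd_one_apply (x : State k) : (1 : Bdd k) x = 1 := by
  rw [lp.infty_coeFn_one]; rfl

@[simp] lemma bdd_mul_apply (f g : Bdd k) (x : State k) : (f * g) x = f x * g x := by
  rw [lp.infty_coeFn_mul]; rfl

@[simp] lemma bdd_add_apply (f g : Bdd k) (x : State k) : (f + g) x = f x + g x := rfl

@[simp] lemma bdd_sub_apply (f g : Bdd k) (x : State k) : (f - g) x = f x - g x := rfl

@[simp] lemma bdd_smul_apply (c : ℝ) (f : Bdd k) (x : State k) : (c • f) x = c * f x := rfl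

/-- The indicator function of a state. -/
noncomputable def ind (y : State k) : Bdd k := lp.single ∞ y (1 : ℝ)

lemma ind_apply (y x : State k) : ind y x = if x = y then 1 else 0 := by
  by_cases h : x = y
  · subst h; simp [ind]
  · simp [ind, h]

lemma ind_nonneg (y x : State k) : 0 ≤ ind y x := by
  rw [ind_apply]; split_ifs <;> norm_num

/-- An operator on `ℓ^∞` is normal if it respects bounded pointwise limits. -/
def IsNormalOp (A : Bdd k →L[ℝ] Bdd k) : Prop :=
  ∀ ⦃ι : Type⦄ (l : Filter ι) (f : ι → Bdd k) (g : Bdd k) (C : ℝ), (∀ᶠ t in l, ‖f t‖ ≤ C) →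
    (∀ x, Tendsto (fun t => f t x) l (𝓝 (g x))) → ∀ x, Tendsto (fun t => A (f t) x) l (𝓝 (A g x))

lemma IsNormalOp.pow {A : Bdd k →L[ℝ] Bdd k} (hA : IsNormalOp A) (n : ℕ) :
    IsNormalOp (A ^ n) := by
  induction n with
  | zero => exact fun _ l f g C _ h x => h x
  | succ n ih =>
    intro ι l f g C hC h x
    rw [pow_succ]
    refine ih l (fun t => A (f t)) (A g) (‖A‖ * C)
      (hC.mono fun t ht => ?_) (hA l f g C hC h) x
    exact (A.le_opNorm _).trans (mul_le_mul_of_nonneg_left ht (norm_nonneg _))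

lemma hasSum_exp_smul_apply_apply (A : Bdd k →L[ℝ] Bdd k) (t : ℝ) (f : Bdd k) (x : State k) :
    HasSum (fun n : ℕ => (n.factorial : ℝ)⁻¹ * t ^ n * (A ^ n) f x)
      (NormedSpace.exp (t • A) f x) :=
  (hasSum_exp_smul_apply A t f).mapL (lp.evalCLM ℝ (fun _ : State k => ℝ) ∞ x)

/-- Dominated convergence for the exponential series. It holds for every filter, which matters
because the limits are later taken along ultrafilters. -/
lemma IsNormalOp.exp_smul {A : Bdd k →L[ℝ] Bdd k} (hA : IsNormalOp A) (s : ℝ) :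
    IsNormalOp (NormedSpace.exp (s • A)) := by
  intro ι l f g C hC h x
  have hs : Summable fun n : ℕ => (n.factorial : ℝ)⁻¹ * |s| ^ n * (‖A‖ ^ n * C) := by
    have := (Real.summable_pow_div_factorial (|s| * ‖A‖)).mul_right C
    refine this.congr fun n => ?_
    rw [mul_pow]
    ring
  have := tendsto_tsum_of_dominated_convergence (𝓕 := l)
    (f := fun t (n : ℕ) => (n.factorial : ℝ)⁻¹ * s ^ n * (A ^ n) (f t) x)
    (g := fun n : ℕ => (n.factorial : ℝ)⁻¹ * s ^ n * (A ^ n) g x) hs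
    (fun n => (hA.pow n l f g C hC h x).const_mul _)
    (hC.mono fun t ht n => by
      rw [norm_mul, norm_mul, norm_pow, Real.norm_eq_abs s,
        Real.norm_of_nonneg (by positivity : 0 ≤ ((n.factorial : ℝ)⁻¹))]
      refine mul_le_mul_of_nonneg_left ((bdd_abs_le _ x).trans ?_) (by positivity)
      exact (norm_pow_apply_le A n _).trans
        (mul_le_mul_of_nonneg_left ht (by positivity)))
  simp_rw [(hasSum_exp_smul_apply_apply A s _ x).tsum_eq] at this
  exact this

variable (Q : CoxQueue k)

/-- A rate exceeding all the exit rates. -/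
noncomputable def unifRate : ℝ := (∑ i : Fin k, Q.lam i) + Q.mu + 1

lemma unifRate_sub (i : Fin k) : 1 ≤ Q.unifRate - Q.lam i - Q.mu := by
  have := Finset.single_le_sum (f := fun i : Fin k => Q.lam i)
    (fun i _ => (Q.lam_pos i i.2).le) (Finset.mem_univ i)
  simp only [unifRate]
  linarith

variable [NeZero k]

lemma gen_apply (f : Bdd k) (x : State k) : Q.gen f x = Q.genFun f x := rfl

lemma isNormalOp_gen : IsNormalOp Q.gen := by
  intro ι l f g C _ h x
  have hd : ∀ (a : ℝ) (y : State k),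
      Tendsto (fun t => a * (f t y - f t x)) l (𝓝 (a * (g y - g x))) := fun a y =>
    ((h y).sub (h x)).const_mul a
  simp only [gen_apply, genFun]
  exact ((hd _ _).add (hd _ _)).add (tendsto_finsetSum _ fun j _ => hd _ _)

/-- The transition semigroup `P_t = exp (t G)`. -/
noncomputable def semigroup (t : ℝ) : Bdd k →L[ℝ] Bdd k := NormedSpace.exp (t • Q.gen)

lemma trans_eq (t : ℝ) (x y : State k) : Q.trans t x y = Q.semigroup t (ind y) x := rfl

lemma isNormalOp_semigroup (t : ℝ) : IsNormalOp (Q.semigroup t) := Q.isNormalOp_gen.exp_smul t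

lemma semigroup_zero_apply (f : Bdd k) : Q.semigroup 0 f = f :=
  DFunLike.congr_fun (exp_zero_smul Q.gen) f

lemma semigroup_add_apply (s t : ℝ) (f : Bdd k) :
    Q.semigroup (s + t) f = Q.semigroup s (Q.semigroup t f) :=
  DFunLike.congr_fun (exp_add_smul Q.gen s t) f

lemma hasDerivAt_semigroup (f : Bdd k) (t : ℝ) :
    HasDerivAt (fun s => Q.semigroup s f) (Q.semigroup t (Q.gen f)) t :=
  hasDerivAt_exp_smul_apply Q.gen f t

lemma hasDerivAt_semigroup' (f : Bdd k) (t : ℝ) :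
    HasDerivAt (fun s => Q.semigroup s f) (Q.gen (Q.semigroup t f)) t :=
  hasDerivAt_exp_smul_apply' Q.gen f t

lemma hasDerivAt_semigroup_apply (f : Bdd k) (x : State k) (t : ℝ) :
    HasDerivAt (fun s => Q.semigroup s f x) (Q.semigroup t (Q.gen f) x) t :=
  (lp.evalCLM ℝ (fun _ : State k => ℝ) ∞ x).hasFDerivAt.comp_hasDerivAt t
    (Q.hasDerivAt_semigroup f t)

lemma gen_one : Q.gen 1 = 0 := by
  ext x
  simp [gen_apply, genFun]

lemma semigroup_one (t : ℝ) : Q.semigroup t 1 = 1 := by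
  refine (hasSum_exp_smul_apply Q.gen t 1).unique ?_
  have h : ∀ n : ℕ, n ≠ 0 →
      ((n.factorial : ℝ)⁻¹ * t ^ n) • (Q.gen ^ n) (1 : Bdd k) = 0 := by
    intro n hn
    obtain ⟨m, rfl⟩ := Nat.exists_eq_succ_of_ne_zero hn
    rw [pow_succ Q.gen, ContinuousLinearMap.mul_def, ContinuousLinearMap.comp_apply, gen_one,
      map_zero, smul_zero]
  simpa using hasSum_single 0 h

/-! ### Positivity -/

/-- The generator, shifted to a positive operator. -/
noncomputable def posGen : Bdd k →L[ℝ] Bdd k := Q.gen + Q.unifRate • 1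

lemma posGen_apply (f : Bdd k) (x : State k) :
    Q.posGen f x = Q.q x.2 * Q.lam x.2 * f (x.1, x.2 + 1)
      + (1 - Q.q x.2) * Q.lam x.2 * f (x.1 + 1, 0)
      + ∑ j ∈ Finset.Icc 1 Q.b, Q.mu * Q.p j * f (x.1 - j, x.2)
      + (Q.unifRate - Q.lam x.2 - Q.mu) * f x := by
  change Q.genFun f x + Q.unifRate * f x = _
  have : ∑ j ∈ Finset.Icc 1 Q.b, Q.mu * Q.p j * (f (x.1 - j, x.2) - f x)
      = ∑ j ∈ Finset.Icc 1 Q.b, Q.mu * Q.p j * f (x.1 - j, x.2) - Q.mu * f x := by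
    simp_rw [mul_sub, Finset.sum_sub_distrib, ← Finset.sum_mul, ← Finset.mul_sum]
    rw [Q.p_sum, mul_one]
  rw [genFun, this]
  ring

variable {Q}

lemma posGen_nonneg {f : Bdd k} (hf : ∀ x, 0 ≤ f x) (x : State k) : 0 ≤ Q.posGen f x := by
  rw [posGen_apply]
  have hq0 := Q.q_nonneg x.2.2
  have hq1 := sub_nonneg.2 (Q.q_le x.2.2)
  have hl := (Q.lam_pos x.2 x.2.2).le
  have hu : 0 ≤ Q.unifRate - Q.lam x.2 - Q.mu := zero_le_one.trans (Q.unifRate_sub x.2)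
  refine add_nonneg (add_nonneg (add_nonneg ?_ ?_) (Finset.sum_nonneg fun j hj => ?_)) ?_
  · exact mul_nonneg (mul_nonneg hq0 hl) (hf _)
  · exact mul_nonneg (mul_nonneg hq1 hl) (hf _)
  · exact mul_nonneg (mul_nonneg Q.mu_pos.le (Q.p_nonneg j hj)) (hf _)
  · exact mul_nonneg hu (hf _)

lemma posGen_pow_nonneg {f : Bdd k} (hf : ∀ x, 0 ≤ f x) (n : ℕ) (x : State k) :
    0 ≤ (Q.posGen ^ n) f x := by
  induction n generalizing x with
  | zero => exact hf x
  | succ n ih =>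
    rw [pow_succ']
    exact posGen_nonneg ih x

variable (Q)

lemma semigroup_eq (t : ℝ) (f : Bdd k) (x : State k) :
    Q.semigroup t f x = Real.exp (-(t * Q.unifRate)) * NormedSpace.exp (t • Q.posGen) f x := by
  rw [semigroup, exp_smul_eq_shift Q.gen Q.unifRate t]
  rfl

variable {Q}

lemma exp_posGen_hasSum (f : Bdd k) (t : ℝ) (x : State k) :
    HasSum (fun n : ℕ => (n.factorial : ℝ)⁻¹ * t ^ n * (Q.posGen ^ n) f x)
      (NormedSpace.exp (t • Q.posGen) f x) :=
  hasSum_exp_smul_apply_apply Q.posGen t f x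

lemma semigroup_nonneg {f : Bdd k} (hf : ∀ x, 0 ≤ f x) {t : ℝ} (ht : 0 ≤ t) (x : State k) :
    0 ≤ Q.semigroup t f x := by
  rw [semigroup_eq]
  refine mul_nonneg (Real.exp_pos _).le ((exp_posGen_hasSum f t x).nonneg fun n => ?_)
  have := posGen_pow_nonneg (Q := Q) hf n x
  positivity

lemma semigroup_mono {f g : Bdd k} (hfg : ∀ x, f x ≤ g x) {t : ℝ} (ht : 0 ≤ t) (x : State k) :
    Q.semigroup t f x ≤ Q.semigroup t g x := by
  have := semigroup_nonneg (Q := Q) (f := g - f) (fun x => sub_nonneg.2 (hfg x)) ht x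
  rw [map_sub] at this
  exact sub_nonneg.1 this

lemma semigroup_pos_of_posGen_pow_pos {f : Bdd k} (hf : ∀ x, 0 ≤ f x) {t : ℝ} (ht : 0 < t)
    (x : State k) (n : ℕ) (h : 0 < (Q.posGen ^ n) f x) : 0 < Q.semigroup t f x := by
  rw [semigroup_eq]
  refine mul_pos (Real.exp_pos _) ?_
  have hs := exp_posGen_hasSum (Q := Q) f t x
  have h1 : 0 < (n.factorial : ℝ)⁻¹ * t ^ n * (Q.posGen ^ n) f x := by positivity
  refine h1.trans_le (le_hasSum hs n fun m _ => ?_)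
  have := posGen_pow_nonneg (Q := Q) hf m x
  positivity

lemma semigroup_ind_self_pos {t : ℝ} (ht : 0 < t) (x : State k) :
    0 < Q.semigroup t (ind x) x :=
  semigroup_pos_of_posGen_pow_pos (ind_nonneg x) ht x 0 (by simp [ind_apply])

lemma posGen_ind_phase_pos {m : ℕ} {i : Fin k} (hi : (i : ℕ) + 1 < k) :
    0 < Q.posGen (ind (m, i + 1)) (m, i) := by
  rw [posGen_apply]
  have h0 := ind_nonneg (k := k) (m, i + 1)
  have hq1 := sub_nonneg.2 (Q.q_le i.2)
  have hq0 := Q.q_pos i hi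
  have hl := Q.lam_pos i i.2
  have hu : 0 ≤ Q.unifRate - Q.lam i - Q.mu := zero_le_one.trans (Q.unifRate_sub i)
  refine add_pos_of_pos_of_nonneg (add_pos_of_pos_of_nonneg (add_pos_of_pos_of_nonneg ?_ ?_)
    (Finset.sum_nonneg fun j hj => ?_)) (mul_nonneg hu (h0 _))
  · simp only [ind_apply, if_true, mul_one]
    exact mul_pos hq0 hl
  · exact mul_nonneg (mul_nonneg hq1 hl.le) (h0 _)
  · exact mul_nonneg (mul_nonneg Q.mu_pos.le (Q.p_nonneg j hj)) (h0 _)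

lemma posGen_ind_arrival_pos {m : ℕ} {i : Fin k} (hi : (i : ℕ) + 1 = k) :
    0 < Q.posGen (ind (m + 1, 0)) (m, i) := by
  rw [posGen_apply]
  have h0 := ind_nonneg (k := k) (m + 1, 0)
  have hl := Q.lam_pos i i.2
  have hu : 0 ≤ Q.unifRate - Q.lam i - Q.mu := zero_le_one.trans (Q.unifRate_sub i)
  refine add_pos_of_pos_of_nonneg (add_pos_of_pos_of_nonneg (add_pos_of_nonneg_of_pos ?_ ?_)
    (Finset.sum_nonneg fun j hj => ?_)) (mul_nonneg hu (h0 _))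
  · exact mul_nonneg (mul_nonneg (Q.q_nonneg i.2) hl.le) (h0 _)
  · simp only [ind_apply, if_true, mul_one, Q.q_last i hi]
    linarith
  · exact mul_nonneg (mul_nonneg Q.mu_pos.le (Q.p_nonneg j hj)) (h0 _)

lemma fin_mk_add_one {n : ℕ} (hn : n + 1 < k) :
    (⟨n, by omega⟩ : Fin k) + 1 = ⟨n + 1, hn⟩ := by
  ext
  rw [Fin.val_add, Fin.val_one', Nat.mod_eq_of_lt (show 1 < k by omega), Nat.mod_eq_of_lt hn]

/-- A function that takes equal values at the ends of every arrival-process transition is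
constant. -/
lemma eq_of_forall_posGen_pos {g : State k → ℝ}
    (h : ∀ x z, 0 < Q.posGen (ind z) x → g z = g x) (x : State k) : g x = g (0, 0) := by
  -- Equality is symmetric, so undirected connectivity suffices: advance through the phases of a
  -- level, then let the last phase end in an arrival. Services are not needed.
  have hphase : ∀ (m n : ℕ) (hn : n < k), g (m, ⟨n, hn⟩) = g (m, 0) := by
    intro m n
    induction n with
    | zero => intro hn; rfl
    | succ n ih =>
      intro hn
      have hp := posGen_ind_phase_pos (Q := Q) (m := m) (i := ⟨n, by omega⟩) hn
      rw [fin_mk_add_one hn] at hp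
      rw [h _ _ hp, ih]
  have hlevel : ∀ m : ℕ, g (m, 0) = g (0, 0) := by
    intro m
    induction m with
    | zero => rfl
    | succ m ih =>
      have hk := NeZero.pos k
      rw [← ih, ← hphase m (k - 1) (by omega)]
      exact h _ _ (posGen_ind_arrival_pos (Nat.sub_add_cancel hk))
  exact (hphase x.1 x.2 x.2.2).trans (hlevel x.1)

end CoxQueue

namespace CoxQueue

variable {k : ℕ}

/-! ### Expectation with respect to a distribution on the state space -/

lemma IsProb.norm_mul_le {π : State k → ℝ} (hπ : IsProb π) (f : Bdd k) (x : State k) :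
    ‖π x * f x‖ ≤ π x * ‖f‖ := by
  rw [norm_mul, Real.norm_of_nonneg (hπ.1 x)]
  exact mul_le_mul_of_nonneg_left (bdd_abs_le f x) (hπ.1 x)

lemma IsProb.summable_mul {π : State k → ℝ} (hπ : IsProb π) (f : Bdd k) :
    Summable fun x => π x * f x :=
  Summable.of_norm_bounded (hπ.2.summable.mul_right ‖f‖) (hπ.norm_mul_le f)

/-- The expectation of bounded functions under a probability distribution. -/
noncomputable def expect (π : State k → ℝ) (hπ : IsProb π) : Bdd k →L[ℝ] ℝ :=
  LinearMap.mkContinuous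
    { toFun := fun f => ∑' x, π x * f x
      map_add' := fun f g => by
        rw [← (hπ.summable_mul f).tsum_add (hπ.summable_mul g)]
        exact tsum_congr fun x => mul_add _ _ _
      map_smul' := fun c f => by
        rw [RingHom.id_apply, smul_eq_mul, ← tsum_mul_left]
        exact tsum_congr fun x => mul_left_comm _ _ _ }
    1
    (fun f => by
      exact tsum_of_norm_bounded (hπ.2.mul_right ‖f‖) (hπ.norm_mul_le f))

variable {π : State k → ℝ} (hπ : IsProb π)

lemma hasSum_expect (f : Bdd k) : HasSum (fun x => π x * f x) (expect π hπ f) :=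
  (hπ.summable_mul f).hasSum

lemma expect_ind (y : State k) : expect π hπ (ind y) = π y := by
  refine (hasSum_expect hπ (ind y)).unique ?_
  have : ∀ x, x ≠ y → π x * ind y x = 0 := fun x hx => by simp [ind_apply, hx]
  simpa [ind_apply] using hasSum_single y this

lemma expect_one : expect π hπ 1 = 1 :=
  (hasSum_expect hπ 1).unique (by simpa using hπ.2)

lemma expect_smul_one (c : ℝ) : expect π hπ (c • 1) = c := by
  rw [map_smul, expect_one, smul_eq_mul, mul_one]

lemma expect_nonneg {f : Bdd k} (hf : ∀ x, 0 ≤ f x) : 0 ≤ expect π hπ f :=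
  (hasSum_expect hπ f).nonneg fun x => mul_nonneg (hπ.1 x) (hf x)

lemma expect_mono {f g : Bdd k} (h : ∀ x, f x ≤ g x) : expect π hπ f ≤ expect π hπ g :=
  hasSum_le (fun x => mul_le_mul_of_nonneg_left (h x) (hπ.1 x)) (hasSum_expect hπ f)
    (hasSum_expect hπ g)

lemma eq_zero_of_expect_eq_zero (hpos : ∀ x, 0 < π x) {f : Bdd k} (hf : ∀ x, 0 ≤ f x)
    (h : expect π hπ f = 0) (x : State k) : f x = 0 := by
  have h1 := (hasSum_zero_iff_of_nonneg fun x => mul_nonneg (hπ.1 x) (hf x)).1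
    (h ▸ hasSum_expect hπ f)
  exact (mul_eq_zero.1 (congrFun h1 x)).resolve_left (hpos x).ne'

lemma tendsto_expect {ι : Type} {l : Filter ι} {f : ι → Bdd k} {g : Bdd k} {C : ℝ}
    (hC : ∀ᶠ t in l, ‖f t‖ ≤ C) (h : ∀ x, Tendsto (fun t => f t x) l (𝓝 (g x))) :
    Tendsto (fun t => expect π hπ (f t)) l (𝓝 (expect π hπ g)) :=
  tendsto_tsum_of_dominated_convergence (hπ.2.summable.mul_right C)
    (fun x => (h x).const_mul (π x))
    (hC.mono fun t ht x => (hπ.norm_mul_le (f t) x).trans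
      (mul_le_mul_of_nonneg_left ht (hπ.1 x)))

/-! ### Invariant distributions -/

lemma sum_smul_ind_apply (f : Bdd k) (s : Finset (State k)) (x : State k) :
    (∑ y ∈ s, f y • ind y : Bdd k) x = if x ∈ s then f x else 0 := by
  have h := map_sum (lp.evalCLM ℝ (fun _ : State k => ℝ) ∞ x) (fun y => f y • ind y) s
  refine h.trans ?_
  have : ∀ y, lp.evalCLM ℝ (fun _ : State k => ℝ) ∞ x (f y • ind y)
      = if x = y then f y else 0 := fun y => by
    change f y * ind y x = _
    rw [ind_apply, mul_ite, mul_one, mul_zero]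
  simp [this]

variable [NeZero k] {Q : CoxQueue k}

/-- A distribution that satisfies the balance equations annihilates the range of the generator. -/
lemma expect_gen_eq_zero (h : ∀ y, expect π hπ (Q.gen (ind y)) = 0) (f : Bdd k) :
    expect π hπ (Q.gen f) = 0 := by
  let F : Finset (State k) → Bdd k := fun s => ∑ y ∈ s, f y • ind y
  have hF : ∀ s, ‖F s‖ ≤ ‖f‖ := fun s => bdd_norm_le (norm_nonneg f) fun x => by
    rw [sum_smul_ind_apply]
    split_ifs
    · exact bdd_abs_le f x
    · simp
  have hlim : ∀ x, Tendsto (fun s => F s x) atTop (𝓝 (f x)) := fun x => by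
    refine tendsto_const_nhds.congr' ?_
    filter_upwards [eventually_ge_atTop {x}] with s hs
    rw [sum_smul_ind_apply, if_pos (hs (Finset.mem_singleton_self x))]
  have h1 := Q.isNormalOp_gen atTop F f ‖f‖ (Eventually.of_forall hF) hlim
  have h2 : Tendsto (fun s => expect π hπ (Q.gen (F s))) atTop (𝓝 (expect π hπ (Q.gen f))) :=
    tendsto_expect hπ (C := ‖Q.gen‖ * ‖f‖) (Eventually.of_forall fun s =>
      (Q.gen.le_opNorm _).trans (mul_le_mul_of_nonneg_left (hF s) (norm_nonneg _))) h1
  have h3 : ∀ s, expect π hπ (Q.gen (F s)) = 0 := fun s => by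
    simp only [F, map_sum, map_smul, h, smul_zero, Finset.sum_const_zero]
  simp_rw [h3] at h2
  exact (tendsto_nhds_unique h2 tendsto_const_nhds)

lemma expect_semigroup (hinv : ∀ f, expect π hπ (Q.gen f) = 0) (t : ℝ) (f : Bdd k) :
    expect π hπ (Q.semigroup t f) = expect π hπ f := by
  have hd : ∀ s, HasDerivAt (fun s => expect π hπ (Q.semigroup s f)) 0 s := fun s => by
    have := (expect π hπ).hasFDerivAt.comp_hasDerivAt s (Q.hasDerivAt_semigroup' f s)
    rwa [hinv] at this
  have := is_const_of_deriv_eq_zero (fun s => (hd s).differentiableAt) (fun s => (hd s).deriv) t 0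
  simpa only [semigroup_zero_apply] using this

lemma isStationary_of_expect_gen (hinv : ∀ f, expect π hπ (Q.gen f) = 0) : Q.IsStationary π :=
  ⟨hπ, fun t _ y => by
    have := hasSum_expect hπ (Q.semigroup t (ind y))
    rwa [expect_semigroup hπ hinv, expect_ind] at this⟩

/-! ### Convergence to the invariant distribution -/

lemma abs_semigroup_le (f : Bdd k) {t : ℝ} (ht : 0 ≤ t) (x : State k) :
    |Q.semigroup t f x| ≤ ‖f‖ := by
  have h1 : ∀ c : ℝ, Q.semigroup t (c • 1) x = c := fun c => by
    rw [map_smul, semigroup_one]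
    simp
  rw [abs_le]
  constructor
  · rw [← h1 (-‖f‖)]
    refine semigroup_mono (fun y => ?_) ht x
    rw [bdd_smul_apply, bdd_one_apply, mul_one]
    exact (abs_le.1 (bdd_abs_le f y)).1
  · conv_rhs => rw [← h1 ‖f‖]
    exact semigroup_mono (fun y => by simpa using (abs_le.1 (bdd_abs_le f y)).2) ht x

lemma norm_semigroup_apply_le (f : Bdd k) {t : ℝ} (ht : 0 ≤ t) : ‖Q.semigroup t f‖ ≤ ‖f‖ :=
  bdd_norm_le (norm_nonneg f) (abs_semigroup_le f ht)

lemma semigroup_sub_const_sq (f : Bdd k) (t c : ℝ) (x : State k) :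
    Q.semigroup t ((f - c • 1) * (f - c • 1)) x
      = Q.semigroup t (f * f) x - 2 * c * Q.semigroup t f x + c ^ 2 := by
  have : (f - c • 1) * (f - c • 1) = f * f - (2 * c) • f + (c ^ 2) • (1 : Bdd k) := by
    ext y
    simp
    ring
  rw [this, map_add, map_sub, map_smul, map_smul, semigroup_one]
  simp

/-- Nonnegativity of the variance of `f` under the law `P_t(x, ·)`. -/
lemma semigroup_sq_le (f : Bdd k) {t : ℝ} (ht : 0 ≤ t) (x : State k) :
    Q.semigroup t f x * Q.semigroup t f x ≤ Q.semigroup t (f * f) x := by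
  have h := semigroup_nonneg (Q := Q) (f := (f - (Q.semigroup t f x) • 1) *
    (f - (Q.semigroup t f x) • 1)) (fun y => by simpa using mul_self_nonneg _) ht x
  rw [semigroup_sub_const_sq] at h
  linarith

/-- Equality in the Jensen inequality forces a function to be constant. -/
lemma eq_of_semigroup_sq_eq {g : Bdd k} {t : ℝ} (ht : 0 < t)
    (h : ∀ x, Q.semigroup t (g * g) x = Q.semigroup t g x * Q.semigroup t g x) (x : State k) :
    g x = g (0, 0) := by
  have key : ∀ x z, 0 < Q.semigroup t (ind z) x → g z = Q.semigroup t g x := by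
    intro x z hz
    set c := Q.semigroup t g x with hc
    have h0 : Q.semigroup t ((g - c • 1) * (g - c • 1)) x = 0 := by
      rw [semigroup_sub_const_sq, h, ← hc]
      ring
    -- The variance vanishes, so each single state charged by `P_t(x, ·)` contributes nothing to it.
    have h1 : Q.semigroup t (((g z - c) * (g z - c)) • ind z) x ≤ 0 := by
      rw [← h0]
      refine semigroup_mono (fun y => ?_) ht.le x
      by_cases hy : y = z
      · subst hy; simp [ind_apply]
      · simpa [ind_apply, hy] using mul_self_nonneg (g y - c)
    rw [map_smul, bdd_smul_apply] at h1
    have h2 : (g z - c) * (g z - c) ≤ 0 := by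
      by_contra hcon
      exact absurd h1 (not_le.2 (mul_pos (not_le.1 hcon) hz))
    have h3 := mul_self_eq_zero.1 (le_antisymm h2 (mul_self_nonneg _))
    linarith
  refine eq_of_forall_posGen_pos (Q := Q) (g := g) (fun x z hz => ?_) x
  -- Both `x` and its neighbour `z` are charged by `P_t(x, ·)`, so `g` equals `P_t g x` at both.
  rw [key x z (semigroup_pos_of_posGen_pow_pos (ind_nonneg z) ht x 1 (by simpa using hz)),
    key x x (semigroup_ind_self_pos ht x)]

lemma expect_semigroup_sq_antitone (hinv : ∀ f, expect π hπ (Q.gen f) = 0) (f : Bdd k)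
    {s t : ℝ} (hst : s ≤ t) :
    expect π hπ (Q.semigroup t f * Q.semigroup t f)
      ≤ expect π hπ (Q.semigroup s f * Q.semigroup s f) := by
  have h := expect_semigroup hπ hinv (t - s) (Q.semigroup s f * Q.semigroup s f)
  rw [← h, show t = (t - s) + s by ring, semigroup_add_apply, add_sub_cancel_right]
  exact expect_mono hπ fun x => by
    simpa using semigroup_sq_le (Q.semigroup s f) (sub_nonneg.2 hst) x

/-- The second moment under `π` serves as a Lyapunov functional; its strict decrease off the
constants identifies every limit point. -/
theorem tendsto_semigroup (hpos : ∀ x, 0 < π x) (hinv : ∀ f, expect π hπ (Q.gen f) = 0)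
    (f : Bdd k) (x : State k) :
    Tendsto (fun t => Q.semigroup t f x) atTop (𝓝 (expect π hπ f)) := by
  obtain ⟨L, hL⟩ : ∃ L, Tendsto
      (fun t => expect π hπ (Q.semigroup t f * Q.semigroup t f)) atTop (𝓝 L) :=
    ⟨_, tendsto_atTop_ciInf (fun s t hst => expect_semigroup_sq_antitone hπ hinv f hst)
      ⟨0, by
        rintro _ ⟨t, rfl⟩
        exact expect_nonneg hπ fun x => by simpa using mul_self_nonneg _⟩⟩
  -- Along an ultrafilter the bounded values converge at all states simultaneously, so no
  -- subsequence has to be extracted.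
  refine (tendsto_iff_ultrafilter _ _ _).2 fun U hU => ?_
  have hbd : ∀ᶠ t in (U : Filter ℝ), ‖Q.semigroup t f‖ ≤ ‖f‖ :=
    ((eventually_ge_atTop 0).mono fun t ht => norm_semigroup_apply_le f ht).filter_mono hU
  have hcpt : ∀ y, ∃ a ∈ Set.Icc (-‖f‖) ‖f‖,
      Tendsto (fun t => Q.semigroup t f y) (U : Filter ℝ) (𝓝 a) := fun y =>
    isCompact_Icc.ultrafilter_le_nhds (U.map fun t => Q.semigroup t f y) <| by
      rw [le_principal_iff]
      exact hbd.mono fun t ht => abs_le.1 ((bdd_abs_le _ y).trans ht)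
  choose G hG hGlim using hcpt
  obtain ⟨g, hlim⟩ : ∃ g : Bdd k, ∀ y,
      Tendsto (fun t => Q.semigroup t f y) (U : Filter ℝ) (𝓝 (g y)) :=
    ⟨toBdd G ‖f‖ fun y => abs_le.2 (hG y), hGlim⟩
  have hbd2 : ∀ {h : ℝ → Bdd k}, (∀ᶠ t in (U : Filter ℝ), ‖h t‖ ≤ ‖f‖) →
      ∀ᶠ t in (U : Filter ℝ), ‖h t * h t‖ ≤ ‖f‖ * ‖f‖ := fun hh =>
    hh.mono fun t ht => (norm_mul_le _ _).trans
      (mul_le_mul ht ht (norm_nonneg _) (norm_nonneg _))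
  have h1 : Tendsto (fun t => expect π hπ (Q.semigroup t f * Q.semigroup t f)) U
      (𝓝 (expect π hπ (g * g))) :=
    tendsto_expect hπ (hbd2 hbd) fun y => by simpa using (hlim y).mul (hlim y)
  have hlim1 := Q.isNormalOp_semigroup 1 U (fun t => Q.semigroup t f) g ‖f‖ hbd hlim
  have h2 : Tendsto (fun t => expect π hπ (Q.semigroup 1 (Q.semigroup t f) *
      Q.semigroup 1 (Q.semigroup t f))) U (𝓝 (expect π hπ (Q.semigroup 1 g * Q.semigroup 1 g))) :=
    tendsto_expect hπ (hbd2 (hbd.mono fun t ht =>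
      (norm_semigroup_apply_le _ zero_le_one).trans ht)) fun y => by
        simpa using (hlim1 y).mul (hlim1 y)
  have h3 : Tendsto (fun t => expect π hπ (Q.semigroup 1 (Q.semigroup t f) *
      Q.semigroup 1 (Q.semigroup t f))) U (𝓝 L) := by
    have := (hL.comp (tendsto_atTop_add_const_left atTop (1 : ℝ) tendsto_id)).mono_left hU
    simpa only [Function.comp_def, id, semigroup_add_apply] using this
  -- Both sides equal `L`: shifting time by one does not change the limit of the second moments.
  have h4 : expect π hπ (g * g) = expect π hπ (Q.semigroup 1 g * Q.semigroup 1 g) :=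
    (tendsto_nhds_unique h1 (hL.mono_left hU)).trans (tendsto_nhds_unique h3 h2)
  have h5 : expect π hπ (Q.semigroup 1 (g * g) - Q.semigroup 1 g * Q.semigroup 1 g) = 0 := by
    rw [map_sub, expect_semigroup hπ hinv, h4, sub_self]
  have h6 := eq_zero_of_expect_eq_zero hπ hpos (fun y => by
    simpa using semigroup_sq_le (Q := Q) g zero_le_one y) h5
  have h7 := eq_of_semigroup_sq_eq (Q := Q) (g := g) one_pos fun y => by
    simpa using sub_eq_zero.1 (h6 y)
  have h8 : g = g (0, 0) • (1 : Bdd k) := by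
    ext y
    rw [h7]
    simp
  have h9 : expect π hπ g = expect π hπ f := by
    refine tendsto_nhds_unique (tendsto_expect hπ hbd hlim) ?_
    simp_rw [expect_semigroup hπ hinv]
    exact tendsto_const_nhds
  have h10 : g x = expect π hπ f := by
    rw [← h9, h8, expect_smul_one]
    simp
  rw [← h10]
  exact hlim x

theorem isErgodic_of_expect_gen (hpos : ∀ x, 0 < π x)
    (hinv : ∀ f, expect π hπ (Q.gen f) = 0) : Q.IsErgodic :=
  ⟨π, hπ, hpos, fun x y => by
    simpa only [trans_eq, expect_ind] using tendsto_semigroup hπ hpos hinv (ind y) x⟩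

/-! ### Consequences of ergodicity -/

-- By the mean value theorem on `[t, t + 1]`, the derivative takes values `φ (t + 1) - φ t`, which
-- tend to zero, at arbitrarily late times.
omit [NeZero k] in
lemma eq_zero_of_tendsto_deriv {φ φ' : ℝ → ℝ} {a L : ℝ} (hd : ∀ t, HasDerivAt φ (φ' t) t)
    (h : Tendsto φ atTop (𝓝 a)) (h' : Tendsto φ' atTop (𝓝 L)) : L = 0 := by
  have hc : ∀ t : ℝ, ∃ c, t < c ∧ φ' c = φ (t + 1) - φ t := fun t => by
    obtain ⟨c, hc, he⟩ := exists_hasDerivAt_eq_slope φ φ' (lt_add_one t)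
      (fun x _ => (hd x).continuousAt.continuousWithinAt) (fun x _ => hd x)
    exact ⟨c, hc.1, by simpa using he⟩
  choose c hlt hc using hc
  have h1 : Tendsto (fun t => φ' (c t)) atTop (𝓝 L) :=
    h'.comp (tendsto_atTop_mono (fun t => (hlt t).le) tendsto_id)
  have h2 : Tendsto (fun t => φ (t + 1) - φ t) atTop (𝓝 (a - a)) :=
    (h.comp (tendsto_atTop_add_const_right atTop (1 : ℝ) tendsto_id)).sub h
  simp_rw [hc] at h1
  rw [sub_self] at h2
  exact tendsto_nhds_unique h1 h2

/-- Batches have size at most `b`, so the image of an indicator has finite support. Limits in `t`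
can then be taken term by term. -/
lemma gen_ind_eq_sum (y : State k) :
    Q.gen (ind y) = ∑ z ∈ Finset.range (y.1 + Q.b + 1) ×ˢ Finset.univ,
      Q.gen (ind y) z • ind z := by
  ext x
  rw [sum_smul_ind_apply]
  split_ifs with hx
  · rfl
  · have hx' : y.1 + Q.b < x.1 := by
      by_contra hcon
      exact hx (by simp; omega)
    have h0 : ∀ z : State k, y.1 < z.1 → ind y z = 0 := fun z hz => by
      rw [ind_apply, if_neg]
      rintro rfl
      exact lt_irrefl _ hz
    have hsum : ∑ j ∈ Finset.Icc 1 Q.b, Q.mu * Q.p j * (ind y (x.1 - j, x.2) - ind y x) = 0 :=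
      Finset.sum_eq_zero fun j hj => by
        rw [Finset.mem_Icc] at hj
        rw [h0 x (by omega), h0 (x.1 - j, x.2) (by simp only; omega)]
        simp
    rw [gen_apply, genFun, hsum, h0 x (by omega), h0 (x.1, x.2 + 1) (by simp only; omega),
      h0 (x.1 + 1, 0) (by simp only; omega)]
    simp

/-- By the forward equation, `P_t (G 1_y)` is the derivative of `P_t 1_y`. It converges to `π (G
1_y)`, which must therefore be zero. -/
lemma expect_gen_of_tendsto
    (h : ∀ y, Tendsto (fun t : ℝ => Q.trans t (0, 0) y) atTop (𝓝 (π y))) (f : Bdd k) :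
    expect π hπ (Q.gen f) = 0 := by
  refine expect_gen_eq_zero hπ (fun y => ?_) f
  refine eq_zero_of_tendsto_deriv (Q.hasDerivAt_semigroup_apply (ind y) (0, 0)) (h y) ?_
  rw [gen_ind_eq_sum]
  simp only [map_sum, map_smul, expect_ind, smul_eq_mul]
  have hs : ∀ t, (∑ z ∈ Finset.range (y.1 + Q.b + 1) ×ˢ Finset.univ,
      Q.gen (ind y) z • Q.semigroup t (ind z) : Bdd k) (0, 0)
      = ∑ z ∈ Finset.range (y.1 + Q.b + 1) ×ˢ Finset.univ,
        Q.gen (ind y) z * Q.trans t (0, 0) z := fun t =>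
    map_sum (lp.evalCLM ℝ (fun _ : State k => ℝ) ∞ (0, 0)) _ _
  simp_rw [hs]
  exact tendsto_finsetSum _ fun z _ => (h z).const_mul _

theorem IsStationary.eq_of_tendsto {π' : State k → ℝ} (hs : Q.IsStationary π')
    (h : ∀ x y, Tendsto (fun t : ℝ => Q.trans t x y) atTop (𝓝 (π y))) : π' = π := by
  funext y
  obtain ⟨hp, hs⟩ := hs
  have hb : ∀ᶠ t : ℝ in atTop, ‖Q.semigroup t (ind y)‖ ≤ ‖(ind y : Bdd k)‖ :=
    (eventually_ge_atTop 0).mono fun t ht => norm_semigroup_apply_le _ ht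
  have h1 := tendsto_expect hp (g := π y • 1) hb fun x => by
    rw [bdd_smul_apply, bdd_one_apply, mul_one]
    exact h x y
  rw [expect_smul_one] at h1
  refine tendsto_nhds_unique (tendsto_const_nhds.congr' ?_) h1
  filter_upwards [eventually_ge_atTop 0] with t ht
  exact (hs t ht y).unique (hasSum_expect hp _)

end CoxQueue

namespace CoxQueue

variable {k : ℕ}

/-! ### Necessity of the stability condition -/

lemma meanBatch_pos (Q : CoxQueue k) : 0 < Q.meanBatch := by
  refine zero_lt_one.trans_le ?_
  rw [← Q.p_sum]
  refine Finset.sum_le_sum fun j hj => le_mul_of_one_le_left (Q.p_nonneg j hj) ?_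
  exact_mod_cast (Finset.mem_Icc.1 hj).1

variable [NeZero k] (Q : CoxQueue k)

/-- The mean time until the next arrival from phase `i` on, in units of the mean inter-arrival
time. -/
noncomputable def relRemaining (i : ℕ) : ℝ := Q.meanFrom (k - i) i / Q.meanInterarrival

lemma relRemaining_zero : Q.relRemaining 0 = 1 := by
  rw [relRemaining, Nat.sub_zero, ← meanInterarrival_eq_meanFrom,
    div_self Q.meanInterarrival_pos.ne']

/-- First-step analysis of the mean remaining time. In the last phase `i + 1` wraps around to `0`,
harmlessly, since `q` vanishes there. -/
lemma relRemaining_step (i : Fin k) :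
    Q.q i * Q.lam i * (Q.relRemaining i - Q.relRemaining ((i + 1 : Fin k) : ℕ))
      + (1 - Q.q i) * Q.lam i * Q.relRemaining i = 1 / Q.meanInterarrival := by
  have hl := (Q.lam_pos i i.2).ne'
  have hE := Q.meanInterarrival_pos.ne'
  have hm : Q.meanFrom (k - i) i = (Q.lam i)⁻¹ + Q.q i * Q.meanFrom (k - (i + 1)) (i + 1) := by
    rw [show k - (i : ℕ) = (k - (i + 1)) + 1 by have := i.2; omega]
    rfl
  rcases Nat.lt_or_ge ((i : ℕ) + 1) k with h | h
  · have h1 : ((i + 1 : Fin k) : ℕ) = i + 1 := congrArg Fin.val (fin_mk_add_one h)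
    rw [h1]
    simp only [relRemaining, hm]
    field_simp
    ring
  · have h0 : Q.q i = 0 := Q.q_last i (by have := i.2; omega)
    simp only [h0, relRemaining, hm]
    field_simp
    ring

/-- The number of customers, truncated at `N`, corrected by the state of the arrival process. -/
noncomputable def truncLevel (N : ℕ) : Bdd k :=
  toBdd (fun x => ((min x.1 N : ℕ) : ℝ) - Q.relRemaining x.2)
    (N + ∑ i : Fin k, |Q.relRemaining i|) fun x => by
      refine (abs_sub _ _).trans (add_le_add ?_ ?_)
      · rw [Nat.abs_cast]
        exact_mod_cast min_le_right _ _
      · exact Finset.single_le_sum (f := fun i : Fin k => |Q.relRemaining i|)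
          (fun i _ => abs_nonneg _) (Finset.mem_univ x.2)

/-- The indicator function of the levels from `N` on. -/
noncomputable def tailInd (N : ℕ) : Bdd k :=
  toBdd (fun x => if N ≤ x.1 then 1 else 0) 1 fun x => by
    split_ifs <;> simp

/-- Since `relRemaining 0 = 1`, an arrival below level `N` cancels the reset of the phase, leaving
the drift `1 / E[C]`. Truncation loses at most one arrival rate, and only from level `N` on. The
term at `(0, 0)`, where no service takes place, later rules out the critical case. -/
lemma gen_truncLevel_ge (N : ℕ) (x : State k) :
    1 / Q.meanInterarrival - Q.mu * Q.meanBatch + Q.mu * Q.meanBatch * ind (0, 0) x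
      - Q.unifRate * tailInd N x ≤ Q.gen (Q.truncLevel N) x := by
  obtain ⟨m, i⟩ := x
  have hstep := Q.relRemaining_step i
  have hl := Q.lam_pos i i.2
  have hq0 := Q.q_nonneg i.2
  have hq1 := Q.q_le i.2
  have hu := Q.unifRate_sub i
  have hmu := Q.mu_pos
  have harr : -(Q.unifRate * tailInd N (m, i))
      ≤ (1 - Q.q i) * Q.lam i * (((min (m + 1) N : ℕ) : ℝ) - ((min m N : ℕ) : ℝ) - 1) := by
    by_cases h : N ≤ m
    · rw [min_eq_right h, min_eq_right (by omega)]
      simp only [tailInd, toBdd_apply, h, if_true]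
      nlinarith
    · rw [min_eq_left (by omega), min_eq_left (by omega)]
      simp [tailInd, h]
  have hserv : -(Q.mu * Q.meanBatch) + Q.mu * Q.meanBatch * ind (0, 0) (m, i)
      ≤ ∑ j ∈ Finset.Icc 1 Q.b, Q.mu * Q.p j * (((min (m - j) N : ℕ) : ℝ) - (min m N : ℕ)) := by
    rcases Nat.eq_zero_or_pos m with rfl | hm
    · have h1 : ind ((0, 0) : State k) (0, i) ≤ 1 := by
        rw [ind_apply]
        split_ifs <;> norm_num
      have := mul_pos Q.mu_pos Q.meanBatch_pos
      simp only [Nat.zero_sub, sub_self, mul_zero, Finset.sum_const_zero]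
      nlinarith
    · have h1 : ind ((0, 0) : State k) (m, i) = 0 := by
        rw [ind_apply, if_neg]
        rintro h
        simp only [Prod.mk.injEq] at h
        omega
      rw [h1, mul_zero, add_zero, meanBatch, Finset.mul_sum, ← Finset.sum_neg_distrib]
      refine Finset.sum_le_sum fun j hj => ?_
      have hp := mul_nonneg hmu.le (Q.p_nonneg j hj)
      have : ((min m N : ℕ) : ℝ) ≤ (min (m - j) N : ℕ) + (j : ℝ) := by
        exact_mod_cast (by omega : min m N ≤ min (m - j) N + j)
      nlinarith
  have hgen : Q.gen (Q.truncLevel N) (m, i)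
      = Q.q i * Q.lam i * (Q.relRemaining i - Q.relRemaining ((i + 1 : Fin k) : ℕ))
        + (1 - Q.q i) * Q.lam i * Q.relRemaining i
        + (1 - Q.q i) * Q.lam i * (((min (m + 1) N : ℕ) : ℝ) - ((min m N : ℕ) : ℝ) - 1)
        + ∑ j ∈ Finset.Icc 1 Q.b,
            Q.mu * Q.p j * (((min (m - j) N : ℕ) : ℝ) - (min m N : ℕ)) := by
    rw [gen_apply, genFun]
    simp only [truncLevel, toBdd_apply, Fin.val_zero, relRemaining_zero, sub_sub_sub_cancel_right]
    ring
  rw [hgen, hstep]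
  linarith

variable {Q} {π : State k → ℝ} (hπ : IsProb π)

omit [NeZero k] in
lemma tendsto_expect_tailInd : Tendsto (fun N => expect π hπ (tailInd N)) atTop (𝓝 0) := by
  rw [← map_zero (expect π hπ)]
  refine tendsto_expect hπ (C := 1) (Eventually.of_forall fun N => bdd_norm_le zero_le_one
    fun x => ?_) fun x => ?_
  · simp only [tailInd, toBdd_apply]
    split_ifs <;> simp
  · refine tendsto_const_nhds.congr' ?_
    filter_upwards [eventually_gt_atTop x.1] with N hN
    simp [tailInd, hN]

theorem stable_of_expect_gen (hpos : ∀ x, 0 < π x) (hinv : ∀ f, expect π hπ (Q.gen f) = 0) :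
    1 / Q.meanInterarrival < Q.mu * Q.meanBatch := by
  have h : ∀ N, 1 / Q.meanInterarrival - Q.mu * Q.meanBatch + Q.mu * Q.meanBatch * π (0, 0)
      - Q.unifRate * expect π hπ (tailInd N) ≤ 0 := fun N => by
    have := expect_mono hπ (f := (1 / Q.meanInterarrival - Q.mu * Q.meanBatch) • 1
      + (Q.mu * Q.meanBatch) • ind (0, 0) - Q.unifRate • tailInd N) (g := Q.gen (Q.truncLevel N))
      fun x => by simpa using Q.gen_truncLevel_ge N x
    rw [hinv, map_sub, map_add, expect_smul_one, map_smul, map_smul, expect_ind] at this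
    simpa using this
  have h2 := le_of_tendsto (((tendsto_expect_tailInd hπ).const_mul Q.unifRate).const_sub _)
    (Eventually.of_forall h)
  have h3 := mul_pos (mul_pos Q.mu_pos Q.meanBatch_pos) (hpos (0, 0))
  linarith

theorem IsErgodic.stable (h : Q.IsErgodic) : 1 / Q.meanInterarrival < Q.mu * Q.meanBatch := by
  obtain ⟨π, hπ, hpos, hlim⟩ := h
  exact stable_of_expect_gen hπ hpos (expect_gen_of_tendsto hπ (hlim (0, 0)))

end CoxQueue

namespace CoxQueue

variable {k : ℕ}

/-! ### The weights of the arrival phases -/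

section Weights

variable (Q : CoxQueue k)

/-- The rate `μ (1 - φ_Y(γ))`. -/
noncomputable def slack (γ : ℝ) : ℝ := Q.mu * (1 - Q.phi γ)

/-- The weight of phase `i` at the nonzero levels. -/
noncomputable def wt (γ : ℝ) (i : ℕ) : ℝ := ∏ l ∈ Finset.Icc 1 i, Q.q (l - 1) * Q.alpha γ l

/-- The weight of phase `i` at level zero, up to the factor `1 / lam i`. -/
noncomputable def emptyWt (γ : ℝ) (i : ℕ) : ℝ :=
  (∏ s ∈ Finset.range i, Q.q s) *
    (1 + ∑ j ∈ Finset.Icc 1 i, ∏ l ∈ Finset.Icc 1 j, Q.alpha γ l)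

lemma prod_Icc_one_succ (f : ℕ → ℝ) (n : ℕ) :
    ∏ l ∈ Finset.Icc 1 (n + 1), f l = (∏ l ∈ Finset.Icc 1 n, f l) * f (n + 1) :=
  Finset.prod_Icc_succ_top (by omega) f

@[simp] lemma wt_zero (γ : ℝ) : Q.wt γ 0 = 1 := by simp [wt]

@[simp] lemma emptyWt_zero (γ : ℝ) : Q.emptyWt γ 0 = 1 := by simp [emptyWt]

lemma wt_succ (γ : ℝ) (i : ℕ) : Q.wt γ (i + 1) = Q.wt γ i * (Q.q i * Q.alpha γ (i + 1)) := by
  rw [wt, prod_Icc_one_succ, Nat.add_sub_cancel, wt]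

lemma wt_eq (γ : ℝ) (i : ℕ) :
    Q.wt γ i = (∏ s ∈ Finset.range i, Q.q s) * ∏ l ∈ Finset.Icc 1 i, Q.alpha γ l := by
  induction i with
  | zero => simp
  | succ i ih =>
    rw [wt_succ, ih, Finset.prod_range_succ, prod_Icc_one_succ]
    ring

lemma emptyWt_succ (γ : ℝ) (i : ℕ) :
    Q.emptyWt γ (i + 1) = Q.q i * Q.emptyWt γ i + Q.wt γ (i + 1) := by
  rw [wt_eq, emptyWt, emptyWt, Finset.prod_range_succ, Finset.sum_Icc_succ_top (by omega)]
  ring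

lemma phi_le {γ : ℝ} (h0 : 0 ≤ γ) (h1 : γ ≤ 1) : Q.phi γ ≤ γ := by
  calc Q.phi γ ≤ ∑ j ∈ Finset.Icc 1 Q.b, Q.p j * γ := by
        refine Finset.sum_le_sum fun j hj => mul_le_mul_of_nonneg_left ?_ (Q.p_nonneg j hj)
        exact pow_le_of_le_one h0 h1 (by have := (Finset.mem_Icc.1 hj).1; omega)
    _ = γ := by rw [← Finset.sum_mul, Q.p_sum, one_mul]

lemma slack_nonneg {γ : ℝ} (h0 : 0 ≤ γ) (h1 : γ ≤ 1) : 0 ≤ Q.slack γ :=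
  mul_nonneg Q.mu_pos.le (by linarith [Q.phi_le h0 h1])

lemma slack_pos {γ : ℝ} (h0 : 0 ≤ γ) (h1 : γ < 1) : 0 < Q.slack γ :=
  mul_pos Q.mu_pos (by linarith [Q.phi_le h0 h1.le])

lemma alpha_eq (γ : ℝ) (i : ℕ) : Q.alpha γ i = Q.lam (i - 1) / (Q.lam i + Q.slack γ) := by
  rw [alpha, slack]
  ring_nf

variable {Q} {γ : ℝ}

lemma alpha_pos (h0 : 0 ≤ γ) (h1 : γ ≤ 1) {i : ℕ} (hi : i < k) : 0 < Q.alpha γ i := by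
  rw [alpha_eq]
  exact div_pos (Q.lam_pos _ (by omega))
    (add_pos_of_pos_of_nonneg (Q.lam_pos i hi) (Q.slack_nonneg h0 h1))

lemma wt_pos (h0 : 0 ≤ γ) (h1 : γ ≤ 1) {i : ℕ} (hi : i < k) : 0 < Q.wt γ i := by
  refine Finset.prod_pos fun l hl => ?_
  rw [Finset.mem_Icc] at hl
  exact mul_pos (Q.q_pos _ (by omega)) (alpha_pos h0 h1 (by omega))

lemma emptyWt_pos (h0 : 0 ≤ γ) (h1 : γ ≤ 1) {i : ℕ} (hi : i < k) : 0 < Q.emptyWt γ i := by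
  refine mul_pos (Finset.prod_pos fun l hl => ?_)
    (add_pos_of_pos_of_nonneg one_pos (Finset.sum_nonneg fun j hj => Finset.prod_nonneg
      fun l hl => ?_))
  · rw [Finset.mem_range] at hl
    exact Q.q_pos _ (by omega)
  · rw [Finset.mem_Icc] at hj hl
    exact (alpha_pos h0 h1 (by omega)).le

lemma wt_balance (h0 : 0 ≤ γ) (h1 : γ ≤ 1) {i : ℕ} (hi : i + 1 < k) :
    Q.q i * Q.lam i * Q.wt γ i = (Q.lam (i + 1) + Q.slack γ) * Q.wt γ (i + 1) := by
  have : Q.lam (i + 1) + Q.slack γ ≠ 0 :=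
    (add_pos_of_pos_of_nonneg (Q.lam_pos _ hi) (Q.slack_nonneg h0 h1)).ne'
  rw [wt_succ, alpha_eq, Nat.add_sub_cancel]
  field_simp

/-- The sum telescopes, because `(lam (i + 1) + slack) * alpha (i + 1) = lam i`. -/
lemma slack_mul_sum_prod_alpha (h0 : 0 ≤ γ) (h1 : γ ≤ 1) {i : ℕ} (hi : i < k) :
    Q.slack γ * ∑ j ∈ Finset.Icc 1 i, ∏ l ∈ Finset.Icc 1 j, Q.alpha γ l
      = Q.lam 0 - Q.lam i * ∏ l ∈ Finset.Icc 1 i, Q.alpha γ l := by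
  induction i with
  | zero => simp
  | succ i ih =>
    have : Q.lam (i + 1) + Q.slack γ ≠ 0 :=
      (add_pos_of_pos_of_nonneg (Q.lam_pos _ hi) (Q.slack_nonneg h0 h1)).ne'
    have h2 : (Q.lam (i + 1) + Q.slack γ) * Q.alpha γ (i + 1) = Q.lam i := by
      rw [alpha_eq, Nat.add_sub_cancel]
      field_simp
    rw [Finset.sum_Icc_succ_top (by omega), mul_add, ih (by omega), prod_Icc_one_succ]
    linear_combination (∏ l ∈ Finset.Icc 1 i, Q.alpha γ l) * h2

/-- The mass of phase `i` over all levels is proportional to the stationary law of the arrival phase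
alone, with a factor that does not depend on `i`. This gives the normalising constant its product
form. -/
lemma phase_mass (h0 : 0 ≤ γ) (h1 : γ < 1) {i : ℕ} (hi : i < k) :
    Q.lam 0 / Q.lam i * Q.emptyWt γ i + Q.lam 0 / Q.slack γ * Q.wt γ i
      = (1 + Q.lam 0 / Q.slack γ) * (Q.lam 0 / Q.lam i * ∏ s ∈ Finset.range i, Q.q s) := by
  have h := slack_mul_sum_prod_alpha (Q := Q) h0 h1.le hi
  have hs := (Q.slack_pos h0 h1).ne'
  have hl := (Q.lam_pos i hi).ne'
  rw [wt_eq, emptyWt]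
  field_simp
  linear_combination (Q.lam 0 * ∏ s ∈ Finset.range i, Q.q s) * h

variable [NeZero k]

/-- Cyclic summation by parts along the phases. -/
lemma sum_phase_shift {h g : ℕ → ℝ} (hg : ∀ i, i + 1 < k → h i = g (i + 1))
    (hlast : ∀ i, i + 1 = k → h i = 0) (v : Fin k → ℝ) :
    ∑ i : Fin k, h i * v (i + 1) = ∑ i : Fin k, g i * v i - g 0 * v 0 := by
  obtain ⟨n, rfl⟩ := Nat.exists_eq_succ_of_ne_zero (NeZero.ne k)
  rw [Fin.sum_univ_castSucc, Fin.sum_univ_succ (fun i : Fin (n + 1) => g i * v i)]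
  rw [Fin.val_last, hlast n rfl, zero_mul, add_zero, Fin.val_zero, add_sub_cancel_left]
  refine Finset.sum_congr rfl fun i _ => ?_
  rw [Fin.val_castSucc, Fin.coeSucc_eq_succ, Fin.val_succ, hg i (by omega)]

lemma sum_emptyWt_shift (v : Fin k → ℝ) :
    ∑ i : Fin k, Q.q i * Q.emptyWt γ i * v (i + 1)
      = ∑ i : Fin k, (Q.emptyWt γ i - Q.wt γ i) * v i := by
  rw [sum_phase_shift (h := fun i => Q.q i * Q.emptyWt γ i)
    (g := fun i => Q.emptyWt γ i - Q.wt γ i) (fun i _ => by rw [emptyWt_succ]; ring)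
    (fun i hi => by rw [Q.q_last i hi, zero_mul])]
  simp

lemma sum_wt_shift (h0 : 0 ≤ γ) (h1 : γ ≤ 1) (v : Fin k → ℝ) :
    ∑ i : Fin k, Q.q i * Q.lam i * Q.wt γ i * v (i + 1)
      = ∑ i : Fin k, (Q.lam i + Q.slack γ) * Q.wt γ i * v i - (Q.lam 0 + Q.slack γ) * v 0 := by
  rw [sum_phase_shift (h := fun i => Q.q i * Q.lam i * Q.wt γ i)
    (g := fun i => (Q.lam i + Q.slack γ) * Q.wt γ i) (fun i hi => wt_balance h0 h1 hi)
    (fun i hi => by rw [Q.q_last i hi, zero_mul, zero_mul])]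
  simp

lemma sum_emptyWt : ∑ i : Fin k, (1 - Q.q i) * Q.emptyWt γ i = ∑ i : Fin k, Q.wt γ i := by
  have h := sum_emptyWt_shift (Q := Q) (γ := γ) fun _ => 1
  simp only [mul_one, Finset.sum_sub_distrib] at h
  simp only [sub_mul, one_mul, Finset.sum_sub_distrib]
  linarith

lemma sum_wt (h0 : 0 ≤ γ) (h1 : γ ≤ 1) :
    ∑ i : Fin k, (1 - Q.q i) * Q.lam i * Q.wt γ i
      = Q.lam 0 + Q.slack γ - Q.slack γ * ∑ i : Fin k, Q.wt γ i := by
  have h := sum_wt_shift (Q := Q) h0 h1 fun _ => 1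
  simp only [mul_one, add_mul, Finset.sum_add_distrib] at h
  simp only [sub_mul, one_mul, Finset.sum_sub_distrib]
  rw [Finset.mul_sum]
  linarith

lemma sum_fin_eq (f : ℕ → ℝ) : ∑ i : Fin k, f i = f 0 + ∑ i ∈ Finset.Icc 1 (k - 1), f i := by
  obtain ⟨n, rfl⟩ := Nat.exists_eq_succ_of_ne_zero (NeZero.ne k)
  rw [← Finset.sum_range (f := f), Finset.range_eq_Ico, Finset.sum_eq_sum_Ico_succ_bot (by omega)]
  rfl

lemma lam_zero_pos : 0 < Q.lam 0 := Q.lam_pos 0 (NeZero.pos k)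

lemma mul_fixMap :
    (Q.lam 0 + Q.mu) * Q.fixMap γ
      = ∑ i : Fin k, (1 - Q.q i) * Q.lam i * Q.wt γ i + γ * Q.mu * Q.phi γ := by
  have : Q.lam 0 + Q.mu ≠ 0 := (add_pos lam_zero_pos Q.mu_pos).ne'
  rw [fixMap, mul_div_cancel₀ _ this,
    sum_fin_eq (fun i => (1 - Q.q i) * Q.lam i * Q.wt γ i), wt_zero]
  congr 2
  · ring
  · refine Finset.sum_congr rfl fun i _ => ?_
    rw [wt]
    simp only [alpha]
    ring

/-- As `slack` is divisible by `1 - γ`, this form exposes the trivial fixpoint `γ = 1`, which can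
then be divided out. -/
lemma mul_fixMap_sub (h0 : 0 ≤ γ) (h1 : γ ≤ 1) :
    (Q.lam 0 + Q.mu) * (Q.fixMap γ - γ)
      = (1 - γ) * (Q.lam 0 + Q.slack γ) - Q.slack γ * ∑ i : Fin k, Q.wt γ i := by
  rw [mul_sub, mul_fixMap, sum_wt h0 h1, slack]
  ring

lemma fixMap_zero_pos : 0 < Q.fixMap 0 := by
  have h1 : 0 < Q.lam 0 + Q.mu := add_pos lam_zero_pos Q.mu_pos
  refine pos_of_mul_pos_right ?_ h1.le
  rw [mul_fixMap, zero_mul, zero_mul, add_zero]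
  have hk := NeZero.pos k
  refine Finset.sum_pos' (fun i _ => ?_) ⟨⟨k - 1, by omega⟩, Finset.mem_univ _, ?_⟩
  · exact mul_nonneg (mul_nonneg (sub_nonneg.2 (Q.q_le i.2)) (Q.lam_pos i i.2).le)
      (wt_pos le_rfl zero_le_one i.2).le
  · rw [Q.q_last _ (Nat.sub_add_cancel hk), sub_zero, one_mul]
    exact mul_pos (Q.lam_pos _ (by simp only; omega))
      (wt_pos le_rfl zero_le_one (by simp only; omega))

end Weights

/-! ### Existence of the fixpoint -/

section Fixpoint

variable (Q : CoxQueue k)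

/-- The quotient `(1 - φ_Y(γ)) / (1 - γ)`. -/
noncomputable def psi (γ : ℝ) : ℝ :=
  ∑ j ∈ Finset.Icc 1 Q.b, Q.p j * ∑ n ∈ Finset.range j, γ ^ n

lemma one_sub_mul_psi (γ : ℝ) : (1 - γ) * Q.psi γ = 1 - Q.phi γ := by
  have h : ∑ j ∈ Finset.Icc 1 Q.b, Q.p j * (1 - γ ^ j) = 1 - Q.phi γ := by
    simp_rw [mul_sub, Finset.sum_sub_distrib, mul_one, Q.p_sum, phi]
  rw [psi, Finset.mul_sum, ← h]
  refine Finset.sum_congr rfl fun j _ => ?_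
  linear_combination Q.p j * (mul_neg_geom_sum γ j)

lemma psi_one : Q.psi 1 = Q.meanBatch := by
  simp [psi, meanBatch, mul_comm]

lemma slack_eq (γ : ℝ) : Q.slack γ = (1 - γ) * (Q.mu * Q.psi γ) := by
  rw [slack, ← one_sub_mul_psi]
  ring

lemma continuous_phi : Continuous Q.phi := by
  unfold phi
  fun_prop

lemma continuous_psi : Continuous Q.psi := by
  unfold psi
  fun_prop

lemma continuous_slack : Continuous Q.slack := by
  have := Q.continuous_phi
  unfold slack
  fun_prop

lemma continuousOn_wt {i : ℕ} (hi : i < k) :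
    ContinuousOn (fun γ => Q.wt γ i) (Set.Icc 0 1) := by
  refine continuousOn_finsetProd _ fun l hl => ContinuousOn.mul continuousOn_const ?_
  simp_rw [alpha_eq]
  rw [Finset.mem_Icc] at hl
  refine continuousOn_const.div (continuous_const.add Q.continuous_slack).continuousOn
    fun γ hγ => ?_
  exact (add_pos_of_pos_of_nonneg (Q.lam_pos l (by omega)) (Q.slack_nonneg hγ.1 hγ.2)).ne'

lemma slack_one : Q.slack 1 = 0 := by simp [slack_eq]

lemma wt_one {i : ℕ} (hi : i < k) :
    Q.wt 1 i = Q.lam 0 * ((∏ l ∈ Finset.range i, Q.q l) * (Q.lam i)⁻¹) := by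
  induction i with
  | zero => simp [(Q.lam_pos 0 hi).ne']
  | succ i ih =>
    have h1 := (Q.lam_pos i (by omega)).ne'
    have h2 := (Q.lam_pos (i + 1) hi).ne'
    rw [wt_succ, ih (by omega), alpha_eq, slack_one, Finset.prod_range_succ, Nat.add_sub_cancel,
      add_zero]
    field_simp

lemma sum_wt_one : ∑ i : Fin k, Q.wt 1 i = Q.lam 0 * Q.meanInterarrival := by
  rw [meanInterarrival_eq, Finset.mul_sum, Finset.sum_range]
  exact Finset.sum_congr rfl fun i _ => Q.wt_one i.2

theorem exists_fixpoint [NeZero k] (h : 1 / Q.meanInterarrival < Q.mu * Q.meanBatch) :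
    ∃ γ, 0 < γ ∧ γ < 1 ∧ Q.fixMap γ = γ := by
  -- `H` is what remains of `F γ - γ`, up to a positive constant, after the factor `1 - γ` is
  -- removed; its sign at `1` is decided by the stability condition.
  let H : ℝ → ℝ := fun γ => Q.lam 0 + Q.slack γ - Q.mu * Q.psi γ * ∑ i : Fin k, Q.wt γ i
  have hl : 0 < Q.lam 0 := lam_zero_pos
  have hH : ∀ γ, 0 ≤ γ → γ ≤ 1 →
      (Q.lam 0 + Q.mu) * (Q.fixMap γ - γ) = (1 - γ) * H γ := fun γ h0 h1 => by
    rw [mul_fixMap_sub h0 h1]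
    simp only [H]
    conv_lhs => enter [2]; rw [slack_eq]
    ring
  have hcont : ContinuousOn H (Set.Icc 0 1) := by
    refine (continuous_const.add Q.continuous_slack).continuousOn.sub
      ((continuous_const.mul Q.continuous_psi).continuousOn.mul ?_)
    exact continuousOn_finsetSum _ fun i _ => Q.continuousOn_wt i.2
  have hpos0 : 0 < H 0 := by
    have := hH 0 le_rfl zero_le_one
    rw [sub_zero, sub_zero, one_mul] at this
    rw [← this]
    exact mul_pos (add_pos hl Q.mu_pos) fixMap_zero_pos
  have hneg1 : H 1 < 0 := by
    simp only [H, slack_one, psi_one, sum_wt_one]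
    rw [div_lt_iff₀ Q.meanInterarrival_pos] at h
    nlinarith
  obtain ⟨γ, ⟨h0, h1⟩, hγ⟩ := intermediate_value_Ioo' zero_le_one hcont ⟨hneg1, hpos0⟩
  refine ⟨γ, h0, h1, ?_⟩
  have := hH γ h0.le h1.le
  rw [hγ, mul_zero] at this
  exact sub_eq_zero.1 ((mul_eq_zero.1 this).resolve_left (add_pos hl Q.mu_pos).ne')

end Fixpoint

end CoxQueue

namespace CoxQueue

variable {k : ℕ}

/-! ### The matrix-geometric distribution -/

lemma hasSum_state {f : State k → ℝ} {S : Fin k → ℝ}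
    (h : ∀ i, HasSum (fun m : ℕ => f (m + 1, i)) (S i)) :
    HasSum f (∑ i : Fin k, (f (0, i) + S i)) := by
  have h1 : ∀ i : Fin k, HasSum (fun x : State k => if x.2 = i then f x else 0)
      (f (0, i) + S i) := fun i => by
    have hinj : Function.Injective fun m : ℕ => ((m, i) : State k) := fun a b hab =>
      congrArg Prod.fst hab
    refine (hinj.hasSum_iff ?_).1 ?_
    · rintro ⟨m, j⟩ hx
      refine if_neg fun hj => hx ⟨m, ?_⟩
      simp only at hj
      rw [hj]
    · have := (hasSum_nat_add_iff (f := fun m : ℕ => f (m, i)) 1).1 (h i)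
      simpa [Function.comp_def, add_comm] using this
  have h2 := hasSum_sum (s := Finset.univ) fun i _ => h1 i
  simpa using h2

/-- The geometric sum of a bounded function over the nonzero levels in phase `i`. -/
noncomputable def geomSum (γ : ℝ) (f : Bdd k) (i : Fin k) : ℝ := ∑' m : ℕ, γ ^ m * f (m + 1, i)

section Geom

variable {γ : ℝ} (h0 : 0 < γ) (h1 : γ < 1) (f : Bdd k) (i : Fin k)
include h0 h1

lemma hasSum_geomSum : HasSum (fun m : ℕ => γ ^ m * f (m + 1, i)) (geomSum γ f i) := by
  refine Summable.hasSum (Summable.of_norm_bounded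
    ((summable_geometric_of_lt_one h0.le h1).mul_right ‖f‖) fun m => ?_)
  rw [norm_mul, norm_pow, Real.norm_of_nonneg h0.le]
  exact mul_le_mul_of_nonneg_left (bdd_abs_le f _) (pow_nonneg h0.le m)

lemma hasSum_geomSum_arrival :
    HasSum (fun m : ℕ => γ ^ m * f (m + 1 + 1, i)) ((geomSum γ f i - f (1, i)) / γ) := by
  have h := ((hasSum_nat_add_iff' 1).2 (hasSum_geomSum h0 h1 f i)).div_const γ
  simp only [Finset.sum_range_one, pow_zero, one_mul, zero_add] at h
  refine h.congr_fun fun m => ?_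
  rw [pow_succ]
  field_simp

lemma hasSum_geomSum_service (j : ℕ) :
    HasSum (fun m : ℕ => γ ^ m * f (m + 1 - j, i))
      (γ ^ j * geomSum γ f i + (∑ n ∈ Finset.range j, γ ^ n) * f (0, i)) := by
  have h := ((hasSum_geomSum h0 h1 f i).mul_left (γ ^ j))
  have h' : HasSum (fun m : ℕ => γ ^ (m + j) * f (m + j + 1 - j, i))
      (γ ^ j * geomSum γ f i) := by
    refine h.congr_fun fun m => ?_
    rw [show m + j + 1 - j = m + 1 by omega, pow_add]
    ring
  -- The first `j` terms are the levels `1, …, j`, which a batch of size `j` empties.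
  have h2 := (hasSum_nat_add_iff (f := fun m : ℕ => γ ^ m * f (m + 1 - j, i)) j).1 h'
  have h3 : ∑ n ∈ Finset.range j, γ ^ n * f (n + 1 - j, i)
      = (∑ n ∈ Finset.range j, γ ^ n) * f (0, i) := by
    rw [Finset.sum_mul]
    refine Finset.sum_congr rfl fun n hn => ?_
    rw [Finset.mem_range] at hn
    rw [show n + 1 - j = 0 by omega]
  rwa [h3] at h2

variable [NeZero k] (Q : CoxQueue k)

lemma hasSum_geom_gen :
    HasSum (fun m : ℕ => γ ^ m * Q.gen f (m + 1, i))
      (Q.q i * Q.lam i * (geomSum γ f (i + 1) - geomSum γ f i)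
        + (1 - Q.q i) * Q.lam i * ((geomSum γ f 0 - f (1, 0)) / γ - geomSum γ f i)
        + (Q.mu * Q.psi γ * f (0, i) - Q.slack γ * geomSum γ f i)) := by
  have hS := hasSum_geomSum h0 h1 f
  have hA := ((hS (i + 1)).sub (hS i)).mul_left (Q.q i * Q.lam i)
  have hB := ((hasSum_geomSum_arrival h0 h1 f 0).sub (hS i)).mul_left ((1 - Q.q i) * Q.lam i)
  have hC := hasSum_sum (s := Finset.Icc 1 Q.b) fun j _ =>
    ((hasSum_geomSum_service h0 h1 f i j).sub (hS i)).mul_left (Q.mu * Q.p j)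
  have hval : ∑ j ∈ Finset.Icc 1 Q.b, Q.mu * Q.p j *
      (γ ^ j * geomSum γ f i + (∑ n ∈ Finset.range j, γ ^ n) * f (0, i) - geomSum γ f i)
      = Q.mu * Q.psi γ * f (0, i) - Q.slack γ * geomSum γ f i := by
    have h2 : Q.slack γ = Q.mu * (∑ j ∈ Finset.Icc 1 Q.b, Q.p j - Q.phi γ) := by
      rw [Q.p_sum, slack]
    rw [h2, psi, phi, ← Finset.sum_sub_distrib, Finset.mul_sum, Finset.mul_sum, Finset.sum_mul,
      Finset.sum_mul, ← Finset.sum_sub_distrib]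
    exact Finset.sum_congr rfl fun j _ => by ring
  rw [hval] at hC
  refine ((hA.add hB).add hC).congr_fun fun m => ?_
  rw [gen_apply, genFun, mul_add, mul_add, Finset.mul_sum]
  refine congrArg₂ _ (congrArg₂ _ (by ring) (by ring)) (Finset.sum_congr rfl fun j _ => by ring)

end Geom

/-- The unnormalised stationary distribution. -/
noncomputable def geomMass (Q : CoxQueue k) (γ : ℝ) (x : State k) : ℝ :=
  if x.1 = 0 then Q.lam 0 / Q.lam x.2 * Q.emptyWt γ x.2
  else Q.lam 0 * (1 - γ) * γ ^ (x.1 - 1) / Q.slack γ * Q.wt γ x.2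

/-- The total mass of `geomMass`. -/
noncomputable def geomTotal (Q : CoxQueue k) (γ : ℝ) : ℝ :=
  (1 + Q.lam 0 / Q.slack γ) *
    ∑ i : Fin k, Q.lam 0 / Q.lam i * ∏ s ∈ Finset.range (i : ℕ), Q.q s

/-- The explicit stationary distribution. -/
noncomputable def geomDist (Q : CoxQueue k) (γ : ℝ) (x : State k) : ℝ :=
  (Q.geomTotal γ)⁻¹ * Q.geomMass γ x

section Dist

variable {Q : CoxQueue k} {γ : ℝ}

lemma geomMass_zero (i : Fin k) :
    Q.geomMass γ (0, i) = Q.lam 0 / Q.lam i * Q.emptyWt γ i := rfl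

lemma geomMass_succ (m : ℕ) (i : Fin k) :
    Q.geomMass γ (m + 1, i)
      = Q.lam 0 * (1 - γ) / Q.slack γ * Q.wt γ i * γ ^ m := by
  rw [geomMass, if_neg (Nat.succ_ne_zero m), Nat.add_sub_cancel]
  ring

variable [NeZero k]

lemma geomMass_pos (h0 : 0 < γ) (h1 : γ < 1) (x : State k) : 0 < Q.geomMass γ x := by
  have hl : 0 < Q.lam 0 := lam_zero_pos
  obtain ⟨m, i⟩ := x
  have hw := wt_pos (Q := Q) h0.le h1.le i.2
  have hu := emptyWt_pos (Q := Q) h0.le h1.le i.2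
  have hs := Q.slack_pos h0.le h1
  have hi := Q.lam_pos i i.2
  have h2 := sub_pos.2 h1
  cases m with
  | zero => rw [geomMass_zero]; positivity
  | succ m => rw [geomMass_succ]; positivity

omit [NeZero k] in
lemma hasSum_geomMass (h0 : 0 < γ) (h1 : γ < 1) :
    HasSum (Q.geomMass γ) (Q.geomTotal γ) := by
  have h2 := (sub_pos.2 h1).ne'
  have h3 : ∀ i : Fin k, HasSum (fun m : ℕ => Q.geomMass γ (m + 1, i))
      (Q.lam 0 / Q.slack γ * Q.wt γ i) := fun i => by
    simp_rw [geomMass_succ]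
    have := (hasSum_geometric_of_lt_one h0.le h1).mul_left
      (Q.lam 0 * (1 - γ) / Q.slack γ * Q.wt γ i)
    have hval : Q.lam 0 * (1 - γ) / Q.slack γ * Q.wt γ i * (1 - γ)⁻¹
        = Q.lam 0 / Q.slack γ * Q.wt γ i := by
      field_simp
    rwa [hval] at this
  have h4 := hasSum_state h3
  simp_rw [geomMass_zero] at h4
  rw [Finset.sum_congr rfl fun i _ => phase_mass h0.le h1 i.2, ← Finset.mul_sum] at h4
  exact h4

lemma geomTotal_pos (h0 : 0 < γ) (h1 : γ < 1) : 0 < Q.geomTotal γ :=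
  (geomMass_pos h0 h1 (0, 0)).trans_le
    (le_hasSum (hasSum_geomMass h0 h1) _ fun x _ => (geomMass_pos h0 h1 x).le)

lemma geomDist_pos (h0 : 0 < γ) (h1 : γ < 1) (x : State k) : 0 < Q.geomDist γ x :=
  mul_pos (inv_pos.2 (geomTotal_pos h0 h1)) (geomMass_pos h0 h1 x)

lemma isProb_geomDist (h0 : 0 < γ) (h1 : γ < 1) : IsProb (Q.geomDist γ) :=
  ⟨fun x => (geomDist_pos h0 h1 x).le, by
    have := (hasSum_geomMass (Q := Q) h0 h1).mul_left (Q.geomTotal γ)⁻¹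
    rwa [inv_mul_cancel₀ (geomTotal_pos h0 h1).ne'] at this⟩

/-- The balance equations in dual form: `z` stands for a test function at level zero, `S` for its
geometric sums over the other levels, `a` for its value at `(1, 0)`. The expression is linear in
these. The recursions of `emptyWt` and `wt` cancel all of it except multiples of `a` and `S 0`,
which cancel by the fixpoint equation. -/
lemma geom_balance (h0 : 0 < γ) (h1 : γ < 1) (hfix : Q.fixMap γ = γ) (z S : Fin k → ℝ) (a : ℝ) :
    ∑ i : Fin k, (Q.lam 0 / Q.lam i * Q.emptyWt γ i *
        (Q.q i * Q.lam i * (z (i + 1) - z i) + (1 - Q.q i) * Q.lam i * (a - z i))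
      + Q.lam 0 * (1 - γ) / Q.slack γ * Q.wt γ i *
        (Q.q i * Q.lam i * (S (i + 1) - S i)
        + (1 - Q.q i) * Q.lam i * ((S 0 - a) / γ - S i)
        + (Q.mu * Q.psi γ * z i - Q.slack γ * S i))) = 0 := by
  have hs := (Q.slack_pos h0.le h1).ne'
  -- The coefficient of the flow into level zero by services, freed of its dependence on `γ`.
  have hpsi : Q.lam 0 * (1 - γ) / Q.slack γ * (Q.mu * Q.psi γ) = Q.lam 0 := by
    field_simp
    rw [slack_eq]
    ring
  have hW := mul_fixMap_sub (Q := Q) h0.le h1.le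
  rw [hfix, sub_self, mul_zero] at hW
  have hsum := sum_wt (Q := Q) h0.le h1.le
  have hA : ∑ i : Fin k, (1 - Q.q i) * Q.lam i * Q.wt γ i = γ * (Q.lam 0 + Q.slack γ) := by
    rw [hsum]
    linarith
  have hB := sum_emptyWt (Q := Q) (γ := γ)
  have hz := sum_emptyWt_shift (Q := Q) (γ := γ) z
  have hS := sum_wt_shift (Q := Q) h0.le h1.le S
  set c := Q.lam 0 * (1 - γ) / Q.slack γ with hc
  have hcW : c * (Q.lam 0 + Q.slack γ) = Q.lam 0 * ∑ i : Fin k, Q.wt γ i := by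
    rw [hc]
    field_simp
    linear_combination -Q.lam 0 * hW
  have hterm : ∀ i : Fin k, Q.lam 0 / Q.lam i * Q.emptyWt γ i *
        (Q.q i * Q.lam i * (z (i + 1) - z i) + (1 - Q.q i) * Q.lam i * (a - z i))
      + c * Q.wt γ i *
        (Q.q i * Q.lam i * (S (i + 1) - S i)
        + (1 - Q.q i) * Q.lam i * ((S 0 - a) / γ - S i)
        + (Q.mu * Q.psi γ * z i - Q.slack γ * S i))
      = Q.lam 0 * (Q.q i * Q.emptyWt γ i * z (i + 1))
        - Q.lam 0 * ((Q.emptyWt γ i - Q.wt γ i) * z i)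
        + Q.lam 0 * a * ((1 - Q.q i) * Q.emptyWt γ i)
        + c * (Q.q i * Q.lam i * Q.wt γ i * S (i + 1))
        - c * ((Q.lam i + Q.slack γ) * Q.wt γ i * S i)
        + c * ((S 0 - a) / γ) * ((1 - Q.q i) * Q.lam i * Q.wt γ i) := fun i => by
    have hi : Q.lam 0 / Q.lam i * Q.lam i = Q.lam 0 := div_mul_cancel₀ _ (Q.lam_pos i i.2).ne'
    linear_combination (Q.emptyWt γ i * (Q.q i * (z (i + 1) - z i) + (1 - Q.q i) * (a - z i))) * hi
      + (Q.wt γ i * z i) * hpsi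
  rw [Finset.sum_congr rfl fun i _ => hterm i]
  simp only [Finset.sum_add_distrib, Finset.sum_sub_distrib (ι := Fin k), ← Finset.mul_sum]
  rw [hz, hS, hA, hB]
  have hγ : (S 0 - a) / γ * γ = S 0 - a := div_mul_cancel₀ _ h0.ne'
  linear_combination (c * (Q.lam 0 + Q.slack γ)) * hγ - a * hcW

lemma expect_gen_geomDist (h0 : 0 < γ) (h1 : γ < 1) (hfix : Q.fixMap γ = γ) (f : Bdd k) :
    expect (Q.geomDist γ) (isProb_geomDist h0 h1) (Q.gen f) = 0 := by
  have h2 : ∀ i : Fin k, HasSum (fun m : ℕ => Q.geomMass γ (m + 1, i) * Q.gen f (m + 1, i)) _ :=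
    fun i => ((hasSum_geom_gen h0 h1 f i Q).mul_left
      (Q.lam 0 * (1 - γ) / Q.slack γ * Q.wt γ i)).congr_fun fun m => by
        rw [geomMass_succ]
        ring
  have h3 := hasSum_state (f := fun x => Q.geomMass γ x * Q.gen f x) h2
  have hgen : ∀ i : Fin k, Q.gen f (0, i) = Q.q i * Q.lam i * (f (0, i + 1) - f (0, i))
      + (1 - Q.q i) * Q.lam i * (f (1, 0) - f (0, i)) := fun i => by
    rw [gen_apply, genFun]
    simp
  simp only [geomMass_zero, hgen] at h3
  rw [geom_balance h0 h1 hfix (fun i => f (0, i)) (geomSum γ f) (f (1, 0))] at h3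
  have h4 := h3.mul_left (Q.geomTotal γ)⁻¹
  rw [mul_zero] at h4
  refine (hasSum_expect _ _).unique (h4.congr_fun fun x => ?_)
  rw [geomDist, mul_assoc]

lemma isStationary_geomDist (h0 : 0 < γ) (h1 : γ < 1) (hfix : Q.fixMap γ = γ) :
    Q.IsStationary (Q.geomDist γ) :=
  isStationary_of_expect_gen (isProb_geomDist h0 h1) (expect_gen_geomDist h0 h1 hfix)

theorem isErgodic_of_stable (h : 1 / Q.meanInterarrival < Q.mu * Q.meanBatch) :
    Q.IsErgodic := by
  obtain ⟨γ, h0, h1, hfix⟩ := Q.exists_fixpoint h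
  exact isErgodic_of_expect_gen (isProb_geomDist h0 h1) (geomDist_pos h0 h1)
    (expect_gen_geomDist h0 h1 hfix)

lemma geomDist_zero_zero : Q.geomDist γ (0, 0) = (Q.geomTotal γ)⁻¹ := by
  rw [geomDist, geomMass_zero, Fin.val_zero, emptyWt_zero, div_self lam_zero_pos.ne', mul_one,
    mul_one]

lemma geomDist_two (h0 : 0 < γ) (h1 : γ < 1) :
    Q.geomDist γ (2, 0) / Q.geomDist γ (1, 0) = γ := by
  have h := geomDist_pos (Q := Q) h0 h1 (1, 0)
  rw [div_eq_iff h.ne', geomDist, geomDist, geomMass_succ 1, geomMass_succ 0]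
  ring

end Dist

end CoxQueue

/-! ### Assembly of the main theorem. -/

theorem mainTheorem1 {k : ℕ} [NeZero k] (Q : CoxQueue k) :
    Q.meanInterarrival = ∑ i ∈ Finset.range k, (∏ l ∈ Finset.range i, Q.q l) * (Q.lam i)⁻¹ ∧
    (Q.IsErgodic ↔ 1 / Q.meanInterarrival < Q.mu * Q.meanBatch) ∧
    (Q.IsErgodic →
      ∃ γ : ℝ, (0 < γ ∧ γ < 1 ∧ Q.fixMap γ = γ ∧
          ∀ γ' : ℝ, 0 ≤ γ' → γ' < 1 → Q.fixMap γ' = γ' → γ' = γ) ∧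
        ∃ π : CoxQueue.State k → ℝ,
          Q.IsStationary π ∧ (∀ π' : CoxQueue.State k → ℝ, Q.IsStationary π' → π' = π) ∧
          (∀ (m : ℕ) (i : Fin k), 1 ≤ m →
            π (m, i) = π (0, 0) *
              (Q.lam 0 * (1 - γ) * γ ^ (m - 1) / (Q.mu * (1 - Q.phi γ))) *
              ∏ l ∈ Finset.Icc 1 (i : ℕ), Q.q (l - 1) * Q.alpha γ l) ∧
          (∀ i : Fin k, 1 ≤ (i : ℕ) →
            π (0, i) = π (0, 0) * (Q.lam 0 / Q.lam i) * (∏ s ∈ Finset.range (i : ℕ), Q.q s) *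
              (1 + ∑ j ∈ Finset.Icc 1 (i : ℕ), ∏ l ∈ Finset.Icc 1 j, Q.alpha γ l)) ∧
          π (0, 0) = ((1 + Q.lam 0 / (Q.mu * (1 - Q.phi γ))) *
            (1 + ∑ i ∈ Finset.Icc 1 (k - 1),
              Q.lam 0 / Q.lam i * ∏ j ∈ Finset.range i, Q.q j))⁻¹) := by
  refine ⟨Q.meanInterarrival_eq, ⟨fun h => h.stable, CoxQueue.isErgodic_of_stable⟩, fun h => ?_⟩
  obtain ⟨γ, h0, h1, hfix⟩ := Q.exists_fixpoint h.stable
  obtain ⟨π, _, _, hlim⟩ := h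
  have huniq : ∀ π' : CoxQueue.State k → ℝ, Q.IsStationary π' → π' = Q.geomDist γ := fun π' h' =>
    (h'.eq_of_tendsto hlim).trans
      ((CoxQueue.isStationary_geomDist h0 h1 hfix).eq_of_tendsto hlim).symm
  refine ⟨γ, ⟨h0, h1, hfix, fun γ' h0' h1' hfix' => ?_⟩, Q.geomDist γ,
    CoxQueue.isStationary_geomDist h0 h1 hfix, huniq, fun m i hm => ?_, fun i _ => ?_, ?_⟩
  -- The value `0` is excluded because `F 0 > 0`. A positive fixpoint yields a stationary law, hence
  -- the same one, and `γ` is read off from it.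
  · have hpos : 0 < γ' := h0'.lt_of_ne fun h => by
      rw [← h] at hfix'
      exact CoxQueue.fixMap_zero_pos.ne' hfix'
    rw [← CoxQueue.geomDist_two (Q := Q) hpos h1', ← CoxQueue.geomDist_two (Q := Q) h0 h1,
      huniq _ (CoxQueue.isStationary_geomDist hpos h1' hfix')]
  · rw [CoxQueue.geomDist_zero_zero, CoxQueue.geomDist, CoxQueue.geomMass,
      if_neg (by simp only; omega), CoxQueue.slack, CoxQueue.wt]
    ring
  · rw [CoxQueue.geomDist_zero_zero, CoxQueue.geomDist, CoxQueue.geomMass_zero, CoxQueue.emptyWt]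
    ring
  · rw [CoxQueue.geomDist_zero_zero, CoxQueue.geomTotal, CoxQueue.slack,
      CoxQueue.sum_fin_eq fun i => Q.lam 0 / Q.lam i * ∏ s ∈ Finset.range i, Q.q s,
      Finset.prod_range_zero, mul_one, div_self CoxQueue.lam_zero_pos.ne']
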